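/- Let $A$ be a finite alphabet with $|A|\ge 3$, let $A^*$ be the set of finite words over $A$, and write $u\preccurlyeq v$ if the word $u$ is a (not necessarily contiguous) subword of $v$, i.e. $u$ is obtained from $v$ by deleting letters at an arbitrary set of positions. Consider first-order logic with equality over the structure $(A^*,\preccurlyeq,(w)_{w\in A^*})$, which has the binary relation $\preccurlyeq$ and a constant symbol for every word $w\in A^*$. A $\Sigma_1$-formula is a formula of the form $\exists y_1\cdots\exists y_n\,\theta$ with $n\ge 0$ and $\theta$ quantifier-free. Then for every $k\ge 0$ and every relation $R\subseteq (A^*)^k$, the following are equivalent: 1. $R$ is definable by a $\Sigma_1$-formula, i.e. there is a $\Sigma_1$-formula $\varphi$ with free variables among $x_1,\dots,x_k$ such that $R$ is exactly the set of all $(v_1,\dots,v_k)\in (A^*)^k$ that satisfy $\varphi$; 2. $R$ is recursively enumerable. -/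

import Mathlib

open FirstOrder

/-- The structure `(A*, ≼)`: words over `A` are lists, and the binary symbol of the language of
orders is interpreted as the (non-contiguous) subword relation, which is `List.Sublist`.
(It is not the lexicographic order that `≤` denotes on lists.) -/
instance subwordStructure (A : Type*) : Language.order.Structure (List A) where
  funMap := fun f => Empty.elim f
  RelMap := fun {n} r => match n, r with
    | 2, .le => fun v => (v 0).Sublist (v 1)

/-- The language of `(A*, ≼)` with a constant symbol for every word. Its interpretation in
`List A`, where each constant symbol `w` denotes `w`, is found by instance search. -/
abbrev subwordLanguage (A : Type*) : Language :=
  Language.order[[List A]]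

/-- Definability of a relation `R ⊆ (A*)ᵏ` in the `Σ₁`-fragment over `(A*, ≼)` with all words as
constants: `IsExistential` holds for the formulas `∃ y₁ ⋯ ∃ yₙ, θ` with `n ≥ 0` and `θ`
quantifier-free. -/
def SigmaOneDefinable {A : Type*} {k : ℕ} (R : Set (Fin k → List A)) : Prop :=
  ∃ φ : (subwordLanguage A).Formula (Fin k),
    Language.BoundedFormula.IsExistential φ ∧ ∀ v : Fin k → List A, v ∈ R ↔ φ.Realize v

/-!
A recursively enumerable relation is a projection of a primitive recursive one, so it is enough to
express primitive recursive functions by existential formulas. A number `m` is represented by the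
occurrences of a letter, and a sequence of numbers `f 0, …, f (n - 1)` by the word
`a^(f 0) b ⋯ a^(f (n - 1)) b`. A third letter `c` makes it possible to interleave two such
sequences in one word, whose projections to the pairs of letters `a, b` and `c, b` are then compared
with the two sequences; in this way `+`, `≤` and `=` become definable entrywise. Iterating a
function amounts to the existence of a sequence that agrees entrywise with the image of its own
shift, and a shift is an equation `u ++ w = w' ++ u'` between words. Since sequences can be handled
entrywise, a function whose graph is definable can be applied to all entries at once, which makes
primitive recursion, nested arbitrarily, expressible.

A word is determined by its projections to pairs of letters. The projection to `a, b` is itself the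
code of a sequence, so its code number is the result of an iteration along that sequence.
-/

namespace Subword

open List

universe u

section Definability

open Language

variable {A : Type u} {α β : Type}

/-- Existential definability of a predicate on assignments `α → A*`, with arbitrary finite index
types instead of `Fin k` so that variables need no renumbering: some finite family of words,
indexed by `β`, satisfies a quantifier-free formula together with the given assignment. -/
def Definable (P : (α → List A) → Prop) : Prop :=
  ∃ (β : Type) (_ : Finite β) (θ : (subwordLanguage A).Formula (α ⊕ β)),
    BoundedFormula.IsQF θ ∧ ∀ v, P v ↔ ∃ w : β → List A, θ.Realize (Sum.elim v w)

/-- The atomic formula `s ≼ t`. -/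
def sublistFormula (s t : (subwordLanguage A).Term α) : (subwordLanguage A).Formula α :=
  Relations.formula₂ (Sum.inl Language.leSymb : (subwordLanguage A).Relations 2) s t

theorem isQF_sublistFormula (s t : (subwordLanguage A).Term α) :
    BoundedFormula.IsQF (sublistFormula s t) :=
  (BoundedFormula.IsAtomic.rel _ _).isQF

theorem realize_sublistFormula (s t : (subwordLanguage A).Term α) (v : α → List A) :
    (sublistFormula s t).Realize v ↔ s.realize v <+ t.realize v :=
  Formula.realize_rel₂.trans Iff.rfl

theorem isQF_relabel {θ : (subwordLanguage A).Formula α} (h : BoundedFormula.IsQF θ)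
    (f : α → β) : BoundedFormula.IsQF (θ.relabel f : (subwordLanguage A).Formula β) :=
  BoundedFormula.IsQF.relabel h _

theorem isExistential_exs {n : ℕ} {φ : (subwordLanguage A).BoundedFormula α n}
    (h : φ.IsExistential) : BoundedFormula.IsExistential φ.exs := by
  induction n with
  | zero => exact h
  | succ n ih => exact ih (.ex h)

namespace Definable

theorem sigmaOneDefinable {k : ℕ} {R : Set (Fin k → List A)}
    (h : Definable fun v => v ∈ R) : SigmaOneDefinable R := by
  obtain ⟨β, hβ, θ, hqf, hθ⟩ := h
  refine ⟨θ.iExs β, ?_, fun v => (hθ v).trans Formula.realize_iExs.symm⟩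
  unfold Formula.iExs
  exact isExistential_exs (hqf.relabel _).isExistential

theorem congr {P Q : (α → List A) → Prop} (h : Definable P) (hPQ : ∀ v, Q v ↔ P v) :
    Definable Q := by
  obtain ⟨β, hβ, θ, hqf, hθ⟩ := h
  exact ⟨β, hβ, θ, hqf, fun v => (hPQ v).trans (hθ v)⟩

theorem of_isQF {P : (α → List A) → Prop} {θ : (subwordLanguage A).Formula α}
    (hqf : BoundedFormula.IsQF θ) (h : ∀ v, P v ↔ θ.Realize v) : Definable P :=
  ⟨Empty, inferInstance, θ.relabel Sum.inl, isQF_relabel hqf _, fun v => by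
    simp [h, Formula.realize_relabel]⟩

theorem const (p : Prop) : Definable (A := A) (α := α) fun _ => p := by
  by_cases hp : p
  · exact of_isQF BoundedFormula.IsQF.top fun v => by simp [hp]
  · exact of_isQF BoundedFormula.isQF_bot fun v => by simp [hp]

theorem const_imp (p : Prop) {P : (α → List A) → Prop} (h : p → Definable P) :
    Definable fun v => p → P v := by
  by_cases hp : p
  · exact (h hp).congr fun v => by simp [hp]
  · exact (const True).congr fun v => by simp [hp]

theorem term_eq (s t : (subwordLanguage A).Term α) :
    Definable fun v : α → List A => s.realize v = t.realize v :=
  of_isQF (BoundedFormula.IsAtomic.equal _ _).isQF fun _ => Formula.realize_equal.symm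

theorem term_sublist (s t : (subwordLanguage A).Term α) :
    Definable fun v : α → List A => s.realize v <+ t.realize v :=
  of_isQF (isQF_sublistFormula s t) fun v => (realize_sublistFormula s t v).symm

theorem not_term_sublist (s t : (subwordLanguage A).Term α) :
    Definable fun v : α → List A => ¬ s.realize v <+ t.realize v :=
  of_isQF (isQF_sublistFormula s t).not fun v => (realize_sublistFormula s t v).symm.not

theorem eq (i j : α) : Definable fun v : α → List A => v i = v j :=
  term_eq (var i) (var j)

theorem eq_const (i : α) (w : List A) : Definable fun v : α → List A => v i = w :=
  term_eq (var i) (Constants.term (Language.order.con w))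

theorem sublist (i j : α) : Definable fun v : α → List A => v i <+ v j :=
  term_sublist (var i) (var j)

theorem not_sublist (i j : α) : Definable fun v : α → List A => ¬ v i <+ v j :=
  not_term_sublist (var i) (var j)

theorem const_sublist (w : List A) (i : α) : Definable fun v : α → List A => w <+ v i :=
  term_sublist (Constants.term (Language.order.con w)) (var i)

theorem not_const_sublist (w : List A) (i : α) : Definable fun v : α → List A => ¬ w <+ v i :=
  not_term_sublist (Constants.term (Language.order.con w)) (var i)

theorem and {P Q : (α → List A) → Prop} (hP : Definable P) (hQ : Definable Q) :
    Definable fun v => P v ∧ Q v := by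
  obtain ⟨β, hβ, θ, hqf, hθ⟩ := hP
  obtain ⟨γ, hγ, η, hqf', hη⟩ := hQ
  refine ⟨β ⊕ γ, inferInstance, θ.relabel (Sum.map id .inl) ⊓ η.relabel (Sum.map id .inr),
    (isQF_relabel hqf _).inf (isQF_relabel hqf' _), fun v => ?_⟩
  simp only [hθ, hη, Formula.realize_inf, Formula.realize_relabel, Sum.elim_comp_map,
    Function.comp_id]
  constructor
  · rintro ⟨⟨w, hw⟩, z, hz⟩
    exact ⟨Sum.elim w z, by simpa using hw, by simpa using hz⟩
  · rintro ⟨w, hl, hr⟩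
    exact ⟨⟨_, hl⟩, _, hr⟩

theorem or {P Q : (α → List A) → Prop} (hP : Definable P) (hQ : Definable Q) :
    Definable fun v => P v ∨ Q v := by
  obtain ⟨β, hβ, θ, hqf, hθ⟩ := hP
  obtain ⟨γ, hγ, η, hqf', hη⟩ := hQ
  refine ⟨β ⊕ γ, inferInstance, θ.relabel (Sum.map id .inl) ⊔ η.relabel (Sum.map id .inr),
    (isQF_relabel hqf _).sup (isQF_relabel hqf' _), fun v => ?_⟩
  simp only [hθ, hη, Formula.realize_sup, Formula.realize_relabel, Sum.elim_comp_map,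
    Function.comp_id]
  constructor
  · rintro (⟨w, hw⟩ | ⟨z, hz⟩)
    · exact ⟨Sum.elim w fun _ => [], .inl (by simpa using hw)⟩
    · exact ⟨Sum.elim (fun _ => []) z, .inr (by simpa using hz)⟩
  · rintro ⟨w, hw | hw⟩
    · exact .inl ⟨_, hw⟩
    · exact .inr ⟨_, hw⟩

theorem all {ι : Type*} [Finite ι] {P : ι → (α → List A) → Prop} (h : ∀ i, Definable (P i)) :
    Definable fun v => ∀ i, P i v := by
  classical
  cases nonempty_fintype ι
  have all_mem : ∀ s : Finset ι, Definable fun v => ∀ i ∈ s, P i v := by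
    intro s
    induction s using Finset.induction_on with
    | empty => exact (const True).congr fun v => by simp
    | insert i s _ ih => exact ((h i).and ih).congr fun v => by simp
  exact (all_mem Finset.univ).congr fun v => by simp

theorem subst {P : (α → List A) → Prop} (h : Definable P) (f : α → β) :
    Definable fun v : β → List A => P (fun i => v (f i)) := by
  obtain ⟨γ, hγ, θ, hqf, hθ⟩ := h
  refine ⟨γ, hγ, θ.relabel (Sum.map f id), isQF_relabel hqf _, fun v => (hθ _).trans ?_⟩
  simp only [Formula.realize_relabel, Sum.elim_comp_map]
  rfl

theorem exs [Finite β] {P : (α → List A) → (β → List A) → Prop}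
    (h : Definable fun v : α ⊕ β → List A => P (fun i => v (.inl i)) fun i => v (.inr i)) :
    Definable fun v => ∃ w, P v w := by
  obtain ⟨γ, hγ, θ, hqf, hθ⟩ := h
  refine ⟨β ⊕ γ, inferInstance, θ.relabel (Equiv.sumAssoc α β γ), isQF_relabel hqf _, fun v => ?_⟩
  have hP : ∀ w, P v w ↔ ∃ z : γ → List A, θ.Realize (Sum.elim (Sum.elim v w) z) := fun w => by
    simpa using hθ (Sum.elim v w)
  have assoc : ∀ (w : β → List A) (z : γ → List A),
      Sum.elim v (Sum.elim w z) ∘ Equiv.sumAssoc α β γ = Sum.elim (Sum.elim v w) z := fun w z => by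
    ext ((_ | _) | _) <;> rfl
  simp only [hP, Formula.realize_relabel]
  constructor
  · rintro ⟨w, z, hwz⟩
    exact ⟨Sum.elim w z, by rwa [assoc]⟩
  · rintro ⟨w, hw⟩
    exact ⟨w ∘ .inl, w ∘ .inr, by rwa [← assoc, Sum.elim_comp_inl_inr]⟩

theorem ex {P : (α → List A) → List A → Prop}
    (h : Definable fun v : Option α → List A => P (fun i => v (some i)) (v none)) :
    Definable fun v => ∃ x, P v x := by
  have h' := h.subst (β := α ⊕ Unit) (fun o => o.elim (.inr ()) .inl)
  exact (exs (P := fun v (w : Unit → List A) => P v (w ())) h').congr fun v =>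
    ⟨fun ⟨x, hx⟩ => ⟨fun _ => x, hx⟩, fun ⟨w, hw⟩ => ⟨w (), hw⟩⟩

theorem forall_mem [Finite A] (S : Set A) (i : α) :
    Definable fun v : α → List A => ∀ y ∈ v i, y ∈ S :=
  (all fun y => (const (y ∈ S)).or (not_const_sublist [y] i)).congr fun v => by
    simp only [singleton_sublist, or_iff_not_imp_right, not_not]

theorem notMem (c : A) (i : α) : Definable fun v : α → List A => c ∉ v i :=
  (not_const_sublist [c] i).congr fun _ => singleton_sublist.not.symm

theorem count_eq_one [DecidableEq A] (c : A) (i : α) :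
    Definable fun v : α → List A => (v i).count c = 1 :=
  ((const_sublist (replicate 1 c) i).and (not_const_sublist (replicate 2 c) i)).congr fun v => by
    rw [replicate_sublist_iff, replicate_sublist_iff]
    omega

end Definable

end Definability

section Words

variable {A : Type u} [DecidableEq A] {a b c z : A}

/-- The first `z` of the smaller word must go to the first `z` of the larger one, as otherwise too
few occurrences of `z` would remain. -/
theorem sublist_and_sublist_of_append_cons {s t q r : List A} (hs : z ∉ s) (hq : z ∉ q)
    (hcount : r.count z ≤ t.count z) (h : s ++ z :: t <+ q ++ z :: r) : s <+ q ∧ t <+ r := by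
  obtain ⟨l₁, l₂, hl, h₁, h₂⟩ := sublist_append_iff.1 h
  have hl₁ : z ∉ l₁ := fun hz => hq (h₁.subset hz)
  rcases append_eq_append_iff.1 hl with ⟨m, hm, hm'⟩ | ⟨m, hm, hm'⟩
  · rcases m with _ | ⟨x, m⟩
    · simp only [append_nil] at hm
      simp only [nil_append] at hm'
      rw [← hm'] at h₂
      exact ⟨hm ▸ h₁, h₂.of_cons_cons⟩
    · simp only [cons_append, cons.injEq] at hm'
      exact absurd (by simp [hm, hm'.1]) hl₁
  · rw [hm'] at h₂
    rcases m with _ | ⟨x, m⟩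
    · simp only [append_nil] at hm
      exact ⟨hm ▸ h₁, h₂.of_cons_cons⟩
    · have hx : x ≠ z := fun hx => hs (by simp [hm, hx])
      have hle : (m ++ z :: t).count z ≤ r.count z :=
        (sublist_of_cons_sublist (h₂.of_cons_of_ne hx)).count_le z
      rw [count_append, count_cons_self] at hle
      omega

theorem count_append_cons_eq_one {s t : List A} (hs : z ∉ s) (ht : z ∉ t) :
    (s ++ z :: t).count z = 1 := by
  simp [count_append, count_eq_zero_of_not_mem hs, count_eq_zero_of_not_mem ht]

theorem exists_eq_append_cons_of_count_eq_one {l : List A} (h : l.count z = 1) :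
    ∃ s t, l = s ++ z :: t ∧ z ∉ s ∧ z ∉ t := by
  obtain ⟨s, t, rfl, hs⟩ := eq_append_cons_of_mem (count_pos_iff.1 (by omega : 0 < l.count z))
  refine ⟨s, t, rfl, hs, fun ht => ?_⟩
  have := count_pos_iff.2 ht
  simp only [count_append, count_cons_self] at h
  omega

omit [DecidableEq A] in
theorem replicate_append_cons_sublist_iff (hab : a ≠ b) {k l m n : ℕ} :
    replicate k a ++ b :: replicate l a <+ replicate m a ++ b :: replicate n a ↔
      k ≤ m ∧ l ≤ n := by
  classical
  constructor
  · intro h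
    have h' := sublist_and_sublist_of_append_cons (by simp [hab.symm]) (by simp [hab.symm])
      (by simp [count_replicate, hab]) h
    simpa only [replicate_sublist_replicate] using h'
  · rintro ⟨hkm, hln⟩
    exact ((replicate_sublist_replicate a).2 hkm).append
      (((replicate_sublist_replicate a).2 hln).cons_cons b)

omit [DecidableEq A] in
theorem replicate_sublist_append_cons_iff (hab : a ≠ b) {k m n : ℕ} :
    replicate k a <+ replicate m a ++ b :: replicate n a ↔ k ≤ m + n := by
  classical
  simp [replicate_sublist_iff, count_append, hab.symm]

theorem exists_eq_replicate_append_cons_iff (hab : a ≠ b) (r : ℕ) (v : List A) :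
    (∃ n, v = replicate n a ++ b :: replicate r a) ↔
      (∀ y ∈ v, y ∈ ({a, b} : Set A)) ∧ v.count b = 1 ∧
        (b :: replicate r a) <+ v ∧ ¬ (b :: replicate (r + 1) a) <+ v := by
  have suffix_iff (l m n : ℕ) :
      b :: replicate l a <+ replicate m a ++ b :: replicate n a ↔ l ≤ n := by
    simpa using replicate_append_cons_sublist_iff hab (k := 0) (l := l) (m := m) (n := n)
  constructor
  · rintro ⟨n, rfl⟩
    refine ⟨fun y hy => ?_, by simp [count_replicate, hab], (suffix_iff r n r).2 le_rfl,
      (suffix_iff _ n r).not.2 (by omega)⟩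
    simp only [mem_append, mem_cons, mem_replicate] at hy
    simp only [Set.mem_insert_iff, Set.mem_singleton_iff]
    tauto
  · rintro ⟨hmem, hcount, hle, hlt⟩
    obtain ⟨s, t, rfl, hs, ht⟩ := exists_eq_append_cons_of_count_eq_one hcount
    have hs' : s = replicate s.length a := eq_replicate_of_mem fun y hy =>
      (hmem y (by simp [hy])).resolve_right fun hyb => hs (hyb ▸ hy)
    have ht' : t = replicate t.length a := eq_replicate_of_mem fun y hy =>
      (hmem y (by simp [hy])).resolve_right fun hyb => ht (hyb ▸ hy)
    rw [hs', ht', suffix_iff] at hle hlt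
    exact ⟨s.length, by rw [← hs', ht', show t.length = r by omega]⟩

omit [DecidableEq A] in
/-- For long words, the existential formula squeezes the length `m` of `q` against the length `k`
of `p`: through `z = aⁱbaaa` and `v = aˡb` it says `m ≤ i + 3`, `l + 1 ≤ k` and `i < l`. -/
theorem exists_eq_replicate_and_eq_replicate_succ_iff (hab : a ≠ b) (p q : List A) :
    (∃ n, p = replicate n a ∧ q = replicate (n + 1) a) ↔
      (p = [] ∧ q = [a] ∨ p = [a] ∧ q = [a, a]) ∨
      (∀ y ∈ p, y ∈ ({a} : Set A)) ∧ (∀ y ∈ q, y ∈ ({a} : Set A)) ∧ p <+ q ∧ ¬ q <+ p ∧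
        ∃ z, (∃ i, z = replicate i a ++ b :: replicate 3 a) ∧ ∃ v,
          (∃ l, v = replicate l a ++ b :: replicate 0 a) ∧ q <+ z ∧ ¬ p <+ v ∧ ¬ v <+ z := by
  constructor
  · rintro ⟨_ | _ | n, rfl, rfl⟩
    · simp
    · simp [replicate]
    · right
      refine ⟨fun y => by simp, fun y => by simp, by simp, by simp, _, ⟨n, rfl⟩, _, ⟨n + 1, rfl⟩,
        ?_, ?_, ?_⟩
      · rw [replicate_sublist_append_cons_iff hab]
      · rw [replicate_sublist_append_cons_iff hab]; omega
      · rw [replicate_append_cons_sublist_iff hab]; omega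
  · rintro ((⟨rfl, rfl⟩ | ⟨rfl, rfl⟩) | ⟨hp, hq, hpq, hqp, z, ⟨i, rfl⟩, v, ⟨l, rfl⟩, hqz, hpv, hvz⟩)
    · exact ⟨0, rfl, rfl⟩
    · exact ⟨1, rfl, rfl⟩
    · obtain ⟨k, rfl⟩ : ∃ k, p = replicate k a := ⟨_, eq_replicate_of_mem hp⟩
      obtain ⟨m, rfl⟩ : ∃ m, q = replicate m a := ⟨_, eq_replicate_of_mem hq⟩
      rw [replicate_sublist_append_cons_iff hab] at hqz hpv
      rw [replicate_append_cons_sublist_iff hab] at hvz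
      rw [replicate_sublist_replicate] at hpq hqp
      exact ⟨k, rfl, by rw [show m = k + 1 by omega]⟩

theorem eq_replicate_count_iff (a : A) (u p : List A) :
    p = replicate (u.count a) a ↔
      p <+ u ∧ ∃ q, (∃ n, p = replicate n a ∧ q = replicate (n + 1) a) ∧ ¬ q <+ u := by
  constructor
  · rintro rfl
    exact ⟨replicate_sublist_iff.2 le_rfl, _, ⟨_, rfl, rfl⟩, replicate_sublist_iff.not.2 (by omega)⟩
  · rintro ⟨hp, q, ⟨n, rfl, rfl⟩, hq⟩
    rw [replicate_sublist_iff] at hp hq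
    rw [show u.count a = n by omega]

theorem eq_of_sublist_of_count_eq {u v : List A} (h : u <+ v)
    (hcount : ∀ y, u.count y = v.count y) : u = v :=
  h.eq_of_length (perm_iff_count.2 hcount).length_eq

theorem eq_filter_iff (p : A → Bool) (u v : List A) :
    u = v.filter p ↔ u <+ v ∧ ∀ y, if p y then u.count y = v.count y else y ∉ u := by
  constructor
  · rintro rfl
    refine ⟨filter_sublist, fun y => ?_⟩
    split_ifs with hy
    · exact count_filter hy
    · simp [hy]
  · rintro ⟨h, hcount⟩
    have hp : ∀ y ∈ u, p y := fun y hy => by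
      by_contra hpy
      have := hcount y
      rw [if_neg hpy] at this
      exact this hy
    refine eq_of_sublist_of_count_eq ?_ fun y => ?_
    · simpa only [filter_eq_self.2 hp] using h.filter p
    · have := hcount y
      split_ifs at this with hy
      · rw [this, count_filter hy]
      · rw [count_eq_zero_of_not_mem this, count_eq_zero_of_not_mem (by simp [hy])]

theorem filter_ne_eq_self {s : List A} (h : c ∉ s) : s.filter (· ≠ c) = s :=
  filter_eq_self.2 fun y hy => by simpa using fun hc : y = c => h (hc ▸ hy)

theorem filter_ne_append_cons {s t : List A} (hs : c ∉ s) (ht : c ∉ t) :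
    (s ++ c :: t).filter (· ≠ c) = s ++ t := by
  rw [filter_append, filter_cons_of_neg (by simp), filter_ne_eq_self hs, filter_ne_eq_self ht]

theorem notMem_and_eq_append_singleton_iff (c : A) (u s : List A) :
    (c ∉ u ∧ s = u ++ [c]) ↔ [c] <+ s ∧ (∀ y, ¬ [c, y] <+ s) ∧ u = s.filter (· ≠ c) := by
  constructor
  · rintro ⟨hu, rfl⟩
    refine ⟨by simp, fun y h => ?_, by simpa using (filter_ne_append_cons hu not_mem_nil).symm⟩
    have := (sublist_and_sublist_of_append_cons (s := []) not_mem_nil hu (by simp) h).2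
    simp at this
  · rintro ⟨h₁, h₂, rfl⟩
    refine ⟨by simp, ?_⟩
    obtain ⟨s, t, rfl, hs⟩ := eq_append_cons_of_mem (singleton_sublist.1 h₁)
    rcases t with _ | ⟨y, t⟩
    · rw [filter_ne_append_cons hs not_mem_nil, append_nil]
    · exact absurd (by simp : [c, y] <+ s ++ c :: y :: t) (h₂ y)

theorem notMem_and_eq_cons_iff (c : A) (u s : List A) :
    (c ∉ u ∧ s = c :: u) ↔ [c] <+ s ∧ (∀ y, ¬ [y, c] <+ s) ∧ u = s.filter (· ≠ c) := by
  have := notMem_and_eq_append_singleton_iff c u.reverse s.reverse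
  rw [mem_reverse, ← reverse_cons, reverse_inj] at this
  rw [this, filter_reverse, reverse_inj, ← reverse_sublist (l₁ := [c])]
  simp only [reverse_cons, reverse_nil, nil_append, reverse_reverse]
  refine and_congr_right fun _ => and_congr_left fun _ => forall_congr' fun y => ?_
  rw [← reverse_sublist (l₁ := [y, c])]
  simp

/-- The word `u` is the part of `z` before the only occurrence of `c`. -/
def IsBefore (c : A) (u z : List A) : Prop :=
  ∃ t, c ∉ u ∧ c ∉ t ∧ z = u ++ c :: t

/-- The word `u` is the part of `z` after the only occurrence of `c`. -/
def IsAfter (c : A) (u z : List A) : Prop :=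
  ∃ s, c ∉ s ∧ c ∉ u ∧ z = s ++ c :: u

omit [DecidableEq A] in
theorem isAfter_iff_isBefore_reverse (c : A) (u z : List A) :
    IsAfter c u z ↔ IsBefore c u.reverse z.reverse := by
  constructor
  · rintro ⟨s, hs, hu, rfl⟩
    exact ⟨s.reverse, by simpa using hu, by simpa using hs, by simp⟩
  · rintro ⟨t, hu, ht, hz⟩
    exact ⟨t.reverse, by simpa using ht, by simpa using hu, by simpa using congrArg reverse hz⟩

/-- The word `u` is the maximal word with `uc ≼ z`. -/
theorem isBefore_iff (c : A) (u z : List A) :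
    IsBefore c u z ↔ z.count c = 1 ∧ (∃ e, (c ∉ u ∧ e = u ++ [c]) ∧ e <+ z) ∧
      ∀ x, x = c ∨ ∃ q, q = replicate (u.count x + 1) x ∧
        ∃ f, (c ∉ q ∧ f = q ++ [c]) ∧ ¬ f <+ z := by
  constructor
  · rintro ⟨t, hu, ht, rfl⟩
    refine ⟨count_append_cons_eq_one hu ht, ⟨_, ⟨hu, rfl⟩, by simp⟩, fun x =>
      or_iff_not_imp_left.2 fun hx => ⟨_, rfl, _, ⟨by simp [Ne.symm hx], rfl⟩, fun h => ?_⟩⟩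
    have := (sublist_and_sublist_of_append_cons (by simp [Ne.symm hx]) hu
      (by simp [count_eq_zero_of_not_mem ht]) h).1
    rw [replicate_sublist_iff] at this
    omega
  · rintro ⟨hcount, ⟨_, ⟨hu, rfl⟩, huz⟩, hmax⟩
    obtain ⟨s, t, rfl, hs, ht⟩ := exists_eq_append_cons_of_count_eq_one hcount
    have hus : u <+ s := (sublist_and_sublist_of_append_cons hu hs
      (by simp [count_eq_zero_of_not_mem ht]) huz).1
    refine ⟨t, hu, ht, ?_⟩
    rw [eq_of_sublist_of_count_eq hus fun x => (hus.count_le x).antisymm (not_lt.1 fun hlt => ?_)]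
    rcases hmax x with rfl | ⟨_, rfl, _, ⟨-, rfl⟩, hf⟩
    · rw [count_eq_zero_of_not_mem hs] at hlt
      omega
    · exact hf ((replicate_sublist_iff.2 hlt).append (by simp))

theorem isAfter_iff (c : A) (u z : List A) :
    IsAfter c u z ↔ z.count c = 1 ∧ (∃ e, (c ∉ u ∧ e = c :: u) ∧ e <+ z) ∧
      ∀ x, x = c ∨ ∃ q, q = replicate (u.count x + 1) x ∧
        ∃ f, (c ∉ q ∧ f = c :: q) ∧ ¬ f <+ z := by
  have reverse_cons_sublist (w : List A) : w.reverse ++ [c] <+ z.reverse ↔ c :: w <+ z := by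
    rw [← reverse_cons, reverse_sublist]
  have replicate_sublist (x : A) (n : ℕ) :
      replicate n x ++ [c] <+ z.reverse ↔ c :: replicate n x <+ z := by
    rw [← reverse_cons_sublist, reverse_replicate]
  rw [isAfter_iff_isBefore_reverse, isBefore_iff]
  simp only [count_reverse, mem_reverse, exists_eq_left, and_assoc, exists_and_left,
    reverse_cons_sublist, replicate_sublist]

theorem append_iff (c : A) (u₁ u₂ w : List A) :
    (c ∉ u₁ ∧ c ∉ u₂ ∧ w = u₁ ++ u₂) ↔
      ∃ z, IsBefore c u₁ z ∧ IsAfter c u₂ z ∧ w = z.filter (· ≠ c) := by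
  constructor
  · rintro ⟨h₁, h₂, rfl⟩
    exact ⟨u₁ ++ c :: u₂, ⟨u₂, h₁, h₂, rfl⟩, ⟨u₁, h₁, h₂, rfl⟩, (filter_ne_append_cons h₁ h₂).symm⟩
  · rintro ⟨_, ⟨t, h₁, ht, rfl⟩, ⟨s, hs, h₂, hst⟩, rfl⟩
    obtain ⟨rfl, -, rfl⟩ := (append_cons_inj_of_notMem h₁ ht).1 hst
    exact ⟨h₁, h₂, filter_ne_append_cons h₁ h₂⟩

end Words

namespace Definable

variable {A : Type u} [Finite A] {α : Type} {a b : A}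

theorem exists_eq_replicate_append_cons (hab : a ≠ b) (r : ℕ) (i : α) :
    Definable fun v : α → List A => ∃ n, v i = replicate n a ++ b :: replicate r a := by
  classical
  exact ((forall_mem _ _).and <| (count_eq_one _ _).and <| (const_sublist _ _).and
    (not_const_sublist _ _)).congr fun _ => exists_eq_replicate_append_cons_iff hab r _

variable [Nontrivial A]

theorem exists_eq_replicate_and_eq_replicate_succ (a : A) (i j : α) :
    Definable fun v : α → List A => ∃ n, v i = replicate n a ∧ v j = replicate (n + 1) a := by
  classical
  obtain ⟨b, hb⟩ := exists_ne a
  exact ((((eq_const _ _).and (eq_const _ _)).or ((eq_const _ _).and (eq_const _ _))).or <|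
    (forall_mem _ _).and <| (forall_mem _ _).and <| (sublist _ _).and <| (not_sublist _ _).and <|
    ex <| (exists_eq_replicate_append_cons hb.symm _ _).and <|
    ex <| (exists_eq_replicate_append_cons hb.symm _ _).and <|
    (sublist _ _).and <| (not_sublist _ _).and (not_sublist _ _)).congr
      fun _ => exists_eq_replicate_and_eq_replicate_succ_iff hb.symm _ _

section Count

variable [DecidableEq A]

theorem eq_replicate_count (a : A) (i j : α) :
    Definable fun v : α → List A => v j = replicate ((v i).count a) a :=
  ((sublist _ _).and <| ex <| (exists_eq_replicate_and_eq_replicate_succ _ _ _).and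
    (not_sublist _ _)).congr fun _ => eq_replicate_count_iff a _ _

theorem eq_replicate_count_succ (a : A) (i j : α) :
    Definable fun v : α → List A => v j = replicate ((v i).count a + 1) a :=
  (ex (P := fun v p => p = replicate ((v i).count a) a ∧
      ∃ n, p = replicate n a ∧ v j = replicate (n + 1) a) <|
    (eq_replicate_count _ _ _).and (exists_eq_replicate_and_eq_replicate_succ _ _ _)).congr
    fun v => by simp [replicate_inj]

theorem count_eq_count (a : A) (i j : α) :
    Definable fun v : α → List A => (v i).count a = (v j).count a :=
  (ex (P := fun v p => p = replicate ((v i).count a) a ∧ p = replicate ((v j).count a) a) <|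
    (eq_replicate_count _ _ _).and (eq_replicate_count _ _ _)).congr
    fun v => by simp [replicate_inj]

end Count

theorem filter (p : A → Bool) (i j : α) :
    Definable fun v : α → List A => v j = (v i).filter p := by
  classical
  refine ((sublist _ _).and <| all fun y => ?_).congr fun _ => eq_filter_iff p _ _
  split_ifs
  · exact count_eq_count _ _ _
  · exact notMem _ _

theorem append_singleton (c : A) (i j : α) :
    Definable fun v : α → List A => c ∉ v i ∧ v j = v i ++ [c] := by
  classical
  exact ((const_sublist _ _).and <| (all fun _ => not_const_sublist _ _).and <|
    filter _ _ _).congr fun _ => notMem_and_eq_append_singleton_iff c _ _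

theorem cons (c : A) (i j : α) :
    Definable fun v : α → List A => c ∉ v i ∧ v j = c :: v i := by
  classical
  exact ((const_sublist _ _).and <| (all fun _ => not_const_sublist _ _).and <|
    filter _ _ _).congr fun _ => notMem_and_eq_cons_iff c _ _

theorem isBefore (c : A) (i j : α) :
    Definable fun v : α → List A => IsBefore c (v i) (v j) := by
  classical
  exact ((count_eq_one _ _).and <| (ex <| (append_singleton _ _ _).and (sublist _ _)).and <|
    all fun _ => (const _).or <| ex <| (eq_replicate_count_succ _ _ _).and <|
    ex <| (append_singleton _ _ _).and (not_sublist _ _)).congr fun _ => isBefore_iff c _ _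

theorem isAfter (c : A) (i j : α) :
    Definable fun v : α → List A => IsAfter c (v i) (v j) := by
  classical
  exact ((count_eq_one _ _).and <| (ex <| (cons _ _ _).and (sublist _ _)).and <|
    all fun _ => (const _).or <| ex <| (eq_replicate_count_succ _ _ _).and <|
    ex <| (cons _ _ _).and (not_sublist _ _)).congr fun _ => isAfter_iff c _ _

/-- A letter missing from both words serves as a separator, so concatenation is available on the
words that avoid some letter. -/
theorem append (c : A) (i j k : α) :
    Definable fun v : α → List A => c ∉ v i ∧ c ∉ v j ∧ v k = v i ++ v j := by
  classical
  exact (ex <| (isBefore _ _ _).and <| (isAfter _ _ _).and (filter _ _ _)).congr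
    fun _ => append_iff c _ _ _

theorem append_comm (c : A) (i j : α) :
    Definable fun v : α → List A => c ∉ v i ∧ c ∉ v j ∧ v i ++ v j = v j ++ v i :=
  (ex (P := fun v w => (c ∉ v i ∧ c ∉ v j ∧ w = v i ++ v j) ∧ c ∉ v j ∧ c ∉ v i ∧ w = v j ++ v i) <|
    (append _ _ _ _).and (append _ _ _ _)).congr fun v => by
    simp only [exists_and_left, and_assoc, exists_eq_left]
    tauto

end Definable

section Concat

variable {A B : Type u}

/-- The concatenation `f 0 ⋯ f (n - 1)`. -/
def concat (n : ℕ) (f : ℕ → List A) : List A :=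
  (range n).flatMap f

@[simp]
theorem concat_zero (f : ℕ → List A) : concat 0 f = [] := rfl

theorem concat_succ (n : ℕ) (f : ℕ → List A) : concat (n + 1) f = concat n f ++ f n := by
  simp [concat, range_succ]

theorem concat_succ' (n : ℕ) (f : ℕ → List A) :
    concat (n + 1) f = f 0 ++ concat n fun t => f (t + 1) := by
  simp [concat, range_succ_eq_map, flatMap_map]

theorem concat_add (m n : ℕ) (f : ℕ → List A) :
    concat (m + n) f = concat m f ++ concat n fun t => f (m + t) := by
  simp [concat, range_add, flatMap_map]

theorem concat_congr {n : ℕ} {f g : ℕ → List A} (h : ∀ t < n, f t = g t) :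
    concat n f = concat n g := by
  induction n with
  | zero => rfl
  | succ n ih => rw [concat_succ, concat_succ, ih fun t ht => h t (by omega), h n (by omega)]

theorem filter_concat (p : A → Bool) (n : ℕ) (f : ℕ → List A) :
    (concat n f).filter p = concat n fun t => (f t).filter p := by
  simp [concat, filter_flatMap]

theorem flatMap_concat (σ : A → List B) (n : ℕ) (f : ℕ → List A) :
    (concat n f).flatMap σ = concat n fun t => (f t).flatMap σ := by
  simp [concat, flatMap_assoc]

theorem mem_concat {n : ℕ} {f : ℕ → List A} {y : A} : y ∈ concat n f ↔ ∃ t < n, y ∈ f t := by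
  simp [concat]

theorem concat_sublist {n : ℕ} {f g : ℕ → List A} (h : ∀ t < n, f t <+ g t) :
    concat n f <+ concat n g := by
  induction n with
  | zero => simp
  | succ n ih =>
    rw [concat_succ, concat_succ]
    exact (ih fun t ht => h t (by omega)).append (h n (by omega))

theorem append_concat_comm (n : ℕ) (p : List A) :
    (p ++ concat n fun _ => p) = (concat n fun _ => p) ++ p := by
  rw [← concat_succ n fun _ => p, concat_succ']

variable [DecidableEq A] {z : A} {n : ℕ}

theorem count_concat (z : A) (n : ℕ) (f : ℕ → List A) :
    (concat n f).count z = ∑ t ∈ Finset.range n, (f t).count z := by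
  induction n with
  | zero => simp
  | succ n ih => rw [concat_succ, count_append, ih, Finset.sum_range_succ]

theorem count_concat_append_singleton {s : ℕ → List A} (hs : ∀ t, z ∉ s t) :
    (concat n fun t => s t ++ [z]).count z = n := by
  simp [count_concat, count_append, count_eq_zero_of_not_mem (hs _)]

omit [DecidableEq A] in
theorem sublist_of_concat_sublist {s q : ℕ → List A} {r : List A}
    (hs : ∀ t, z ∉ s t) (hq : ∀ t, z ∉ q t) (hr : z ∉ r)
    (h : (concat n fun t => s t ++ [z]) <+ (concat n fun t => q t ++ [z]) ++ r) :
    ∀ t < n, s t <+ q t := by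
  classical
  induction n generalizing s q with
  | zero => simp
  | succ n ih =>
    simp only [concat_succ', append_assoc, cons_append, nil_append] at h
    have hcount : ((concat n fun t => q (t + 1) ++ [z]) ++ r).count z ≤
        (concat n fun t => s (t + 1) ++ [z]).count z := by
      rw [count_append, count_concat_append_singleton fun t => hs (t + 1),
        count_concat_append_singleton fun t => hq (t + 1), count_eq_zero_of_not_mem hr, add_zero]
    obtain ⟨h₁, h₂⟩ := sublist_and_sublist_of_append_cons (hs 0) (hq 0) hcount h
    rintro (_ | t) ht
    · exact h₁
    · exact ih (fun t => hs (t + 1)) (fun t => hq (t + 1)) h₂ t (by omega)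

theorem exists_eq_concat_of_sublist {q : ℕ → List A} (hq : ∀ t, z ∉ q t) {l : List A}
    (h : l <+ concat n fun t => q t ++ [z]) (hcount : l.count z = n) :
    ∃ s : ℕ → List A, l = (concat n fun t => s t ++ [z]) ∧ ∀ t, s t <+ q t := by
  induction n generalizing l with
  | zero => exact ⟨fun _ => [], by simpa using h, fun t => by simp⟩
  | succ n ih =>
    rw [concat_succ, ← append_assoc] at h
    obtain ⟨l', l₃, rfl, h', h₃⟩ := sublist_append_iff.1 h
    obtain ⟨l₁, l₂, rfl, h₁, h₂⟩ := sublist_append_iff.1 h'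
    have hcount₁ := h₁.count_le z
    have hcount₂ : l₂.count z = 0 := count_eq_zero_of_not_mem fun hz => hq n (h₂.subset hz)
    rw [count_concat_append_singleton hq] at hcount₁
    rw [count_append, count_append, hcount₂] at hcount
    rcases sublist_singleton.1 h₃ with rfl | rfl
    · simp only [count_nil] at hcount
      omega
    · simp only [count_singleton_self] at hcount
      obtain ⟨s, rfl, hs⟩ := ih h₁ (by omega)
      refine ⟨Function.update s n l₂, ?_, fun t => ?_⟩
      · rw [concat_succ, Function.update_self, append_assoc]
        congr 1
        exact concat_congr fun t ht => by rw [Function.update_of_ne ht.ne]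
      · rcases eq_or_ne t n with rfl | ht
        · rwa [Function.update_self]
        · rw [Function.update_of_ne ht]
          exact hs t

end Concat

section Primitive

variable {A : Type u} {p : List A} {x y : A}

/-- A word is primitive if it is nonempty and not a product of two commuting nonempty words;
equivalently, it is not a proper power. -/
def IsPrimitive (p : List A) : Prop :=
  p ≠ [] ∧ ∀ u v, u ≠ [] → v ≠ [] → p = u ++ v → p ≠ v ++ u

theorem IsPrimitive.append_comm_iff (hp : IsPrimitive p) (q : List A) :
    p ++ q = q ++ p ↔ ∃ n, q = concat n fun _ => p := by
  refine ⟨fun h => ?_, ?_⟩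
  · induction hk : q.length using Nat.strong_induction_on generalizing q with
    | _ k ih =>
      rcases eq_or_ne q [] with rfl | hq
      · exact ⟨0, rfl⟩
      rcases append_eq_append_iff.1 h with ⟨m, rfl, hm⟩ | ⟨m, hpm, hpm'⟩
      · have hlt : m.length < k := by
          have := length_pos_iff.2 hp.1
          simp only [length_append] at hk
          omega
        obtain ⟨n, hn⟩ := ih m.length hlt m hm rfl
        exact ⟨n + 1, by rw [concat_succ', ← hn]⟩
      · rcases eq_or_ne m [] with rfl | hm
        · exact ⟨1, by simpa [concat_succ] using hpm.symm⟩
        · exact absurd hpm' (hp.2 q m hq hm hpm)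
  · rintro ⟨n, rfl⟩
    exact append_concat_comm n p

theorem sublist_replicate_append_replicate_iff {N M : ℕ} {l : List A} :
    l <+ replicate N x ++ replicate M y ↔
      ∃ i ≤ N, ∃ j ≤ M, l = replicate i x ++ replicate j y := by
  simp only [sublist_append_iff, sublist_replicate_iff]
  constructor
  · rintro ⟨_, _, rfl, ⟨i, hi, rfl⟩, j, hj, rfl⟩
    exact ⟨i, hi, j, hj, rfl⟩
  · rintro ⟨i, hi, j, hj, rfl⟩
    exact ⟨_, _, rfl, ⟨i, hi, rfl⟩, j, hj, rfl⟩

theorem not_sublist_replicate_append (hxy : x ≠ y) (N M : ℕ) :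
    ¬ [y, x] <+ replicate N x ++ replicate M y := by
  rw [sublist_replicate_append_replicate_iff]
  rintro ⟨_ | i, -, _ | _ | j, -, h⟩ <;> simp_all [replicate_succ]

theorem isPrimitive_replicate_append_replicate (hxy : x ≠ y) {N M : ℕ} (hN : 0 < N) (hM : 0 < M) :
    IsPrimitive (replicate N x ++ replicate M y) := by
  refine ⟨by simp [hN.ne'], fun u v hu hv huv hvu => not_sublist_replicate_append hxy N M ?_⟩
  have hxu : x ∈ u := by
    have := congrArg head? huv
    rw [head?_append_of_ne_nil _ hu, head?_append_of_ne_nil _ (by simp [hN.ne'])] at this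
    exact mem_of_head? (by simpa [head?_replicate, hN.ne'] using this.symm)
  have hyv : y ∈ v := by
    have := congrArg getLast? huv
    rw [getLast?_append_of_ne_nil _ hv, getLast?_append_of_ne_nil _ (by simp [hM.ne'])] at this
    exact mem_of_getLast? (by simpa [getLast?_replicate, hM.ne'] using this.symm)
  rw [hvu]
  exact (singleton_sublist.2 hyv).append (singleton_sublist.2 hxu)

theorem isPrimitive_replicate_append_singleton (hxy : x ≠ y) (N : ℕ) :
    IsPrimitive (replicate N x ++ [y]) := by
  rcases N.eq_zero_or_pos with rfl | hN
  · refine ⟨by simp, fun u v hu hv huv => ?_⟩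
    have := congrArg length huv
    have := length_pos_iff.2 hu
    have := length_pos_iff.2 hv
    simp only [replicate_zero, nil_append, length_singleton, length_append] at *
    omega
  · exact isPrimitive_replicate_append_replicate hxy hN one_pos

theorem exists_eq_replicate_append_replicate_iff (hxy : x ≠ y) (p : List A) :
    (∃ N M, p = replicate N x ++ replicate M y) ↔
      (∀ t ∈ p, t ∈ ({x, y} : Set A)) ∧ ¬ [y, x] <+ p := by
  constructor
  · rintro ⟨N, M, rfl⟩
    refine ⟨fun t ht => ?_, not_sublist_replicate_append hxy _ _⟩
    simp only [mem_append, mem_replicate] at ht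
    simp only [Set.mem_insert_iff, Set.mem_singleton_iff]
    tauto
  · rintro ⟨hmem, hyx⟩
    induction p with
    | nil => exact ⟨0, 0, rfl⟩
    | cons t p ih =>
      rcases hmem t (by simp) with rfl | rfl
      · obtain ⟨N, M, rfl⟩ := ih (fun s hs => hmem s (by simp [hs])) fun h => hyx (h.cons _)
        exact ⟨N + 1, M, rfl⟩
      · refine ⟨0, p.length + 1, ?_⟩
        rw [replicate_succ, replicate_zero, nil_append, ← eq_replicate_of_mem fun s hs => ?_]
        exact (hmem s (by simp [hs])).resolve_left fun h =>
          hyx ((singleton_sublist.2 (h ▸ hs)).cons_cons _)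

theorem exists_pos_eq_replicate_append_replicate_iff (hxy : x ≠ y) (p : List A) :
    (∃ N M, 0 < N ∧ 0 < M ∧ p = replicate N x ++ replicate M y) ↔
      (∀ t ∈ p, t ∈ ({x, y} : Set A)) ∧ [x] <+ p ∧ [y] <+ p ∧ ¬ [y, x] <+ p := by
  constructor
  · rintro ⟨N, M, hN, hM, rfl⟩
    obtain ⟨hmem, hyx⟩ := (exists_eq_replicate_append_replicate_iff hxy _).1 ⟨N, M, rfl⟩
    exact ⟨hmem, by simp [hN.ne'], by simp [hM.ne'], hyx⟩
  · rintro ⟨hmem, hx, hy, hyx⟩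
    obtain ⟨N, M, rfl⟩ := (exists_eq_replicate_append_replicate_iff hxy p).2 ⟨hmem, hyx⟩
    simp only [singleton_sublist, mem_append, mem_replicate, hxy, hxy.symm, and_true, and_false,
      or_false, false_or] at hx hy
    exact ⟨N, M, by omega, by omega, rfl⟩

end Primitive

section Enc

variable {A : Type u} {x y z : A}

/-- The code `x^(f 0) z ⋯ x^(f (n - 1)) z` of the sequence of numbers `f 0, …, f (n - 1)`. -/
def enc (x z : A) (n : ℕ) (f : ℕ → ℕ) : List A :=
  concat n fun t => replicate (f t) x ++ [z]

/-- The word `x^(i 0) y^(j 0) z ⋯ x^(i (n - 1)) y^(j (n - 1)) z`, which codes two sequences. -/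
def encPair (x y z : A) (n : ℕ) (i j : ℕ → ℕ) : List A :=
  concat n fun t => replicate (i t) x ++ replicate (j t) y ++ [z]

theorem enc_congr {n : ℕ} {f g : ℕ → ℕ} (h : ∀ t < n, f t = g t) : enc x z n f = enc x z n g :=
  concat_congr fun t ht => by rw [h t ht]

theorem enc_add {m n : ℕ} (f : ℕ → ℕ) :
    enc x z (m + n) f = enc x z m f ++ enc x z n fun t => f (m + t) :=
  concat_add _ _ _

theorem mem_pair_of_mem_enc {n : ℕ} {f : ℕ → ℕ} : ∀ y ∈ enc x z n f, y ∈ ({x, z} : Set A) := by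
  intro y hy
  obtain ⟨t, -, hy⟩ := mem_concat.1 hy
  simp only [mem_append, mem_replicate, mem_singleton] at hy
  simp only [Set.mem_insert_iff, Set.mem_singleton_iff]
  tauto

theorem notMem_enc (hxy : x ≠ y) (hyz : y ≠ z) {n : ℕ} {f : ℕ → ℕ} : y ∉ enc x z n f := fun h =>
  (mem_pair_of_mem_enc y h).elim hxy.symm hyz

theorem mem_triple_of_mem_encPair {n : ℕ} {i j : ℕ → ℕ} :
    ∀ t ∈ encPair x y z n i j, t ∈ ({x, y, z} : Set A) := by
  intro t ht
  obtain ⟨s, -, ht⟩ := mem_concat.1 ht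
  simp only [mem_append, mem_replicate, mem_singleton] at ht
  simp only [Set.mem_insert_iff, Set.mem_singleton_iff]
  tauto

theorem exists_append_singleton_eq_enc {w : List A} (h : ∀ y ∈ w, y ∈ ({x, z} : Set A)) :
    ∃ n f, w ++ [z] = enc x z (n + 1) f := by
  induction w with
  | nil => exact ⟨0, fun _ => 0, by simp [enc, concat_succ]⟩
  | cons y w ih =>
    obtain ⟨n, f, hf⟩ := ih fun y hy => h y (by simp [hy])
    rw [cons_append, hf]
    rcases h y (by simp) with rfl | rfl
    · exact ⟨n, fun t => if t = 0 then f 0 + 1 else f t,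
        by simp [enc, concat_succ', replicate_succ]⟩
    · exact ⟨n + 1, fun t => if t = 0 then 0 else f (t - 1), by simp [enc, concat_succ' (n + 1)]⟩

theorem exists_eq_enc_iff (hxy : x ≠ y) (hyz : y ≠ z) (w : List A) :
    (∃ n f, w = enc x z n f) ↔ w = [] ∨ ∃ u, (∀ t ∈ u, t ∈ ({x, z} : Set A)) ∧
      ∃ p, p = [z] ∧ y ∉ u ∧ y ∉ p ∧ w = u ++ p := by
  simp only [exists_eq_left, mem_singleton]
  constructor
  · rintro ⟨_ | n, f, rfl⟩
    · exact .inl rfl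
    · have hw : enc x z (n + 1) f = enc x z n f ++ replicate (f n) x ++ [z] := by
        rw [enc, concat_succ, append_assoc, enc]
      refine .inr ⟨_, fun t ht => ?_, fun hy => ?_, hyz, hw⟩
      · exact mem_pair_of_mem_enc t (hw ▸ mem_append_left _ ht)
      · exact notMem_enc hxy hyz (hw ▸ mem_append_left _ hy)
  · rintro (rfl | ⟨u, hu, -, -, rfl⟩)
    · exact ⟨0, fun _ => 0, rfl⟩
    · obtain ⟨n, f, h⟩ := exists_append_singleton_eq_enc hu
      exact ⟨n + 1, f, h⟩

theorem exists_eq_replicate_append_and_eq_enc_const_iff (hxy : x ≠ y) (hxz : x ≠ z) (hyz : y ≠ z)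
    (p q : List A) :
    (∃ n N, p = replicate N x ++ [z] ∧ q = enc x z n fun _ => N) ↔
      (∃ N, p = replicate N x ++ z :: replicate 0 x) ∧ y ∉ p ∧ y ∉ q ∧ p ++ q = q ++ p := by
  constructor
  · rintro ⟨n, N, rfl, rfl⟩
    exact ⟨⟨N, rfl⟩, by simp [hxy.symm, hyz], notMem_enc hxy hyz, append_concat_comm _ _⟩
  · rintro ⟨⟨N, rfl⟩, -, -, h⟩
    obtain ⟨n, hn⟩ := ((isPrimitive_replicate_append_singleton hxz N).append_comm_iff q).1 h
    exact ⟨n, N, rfl, hn⟩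

variable [DecidableEq A]

theorem count_enc_right (h : x ≠ z) (n : ℕ) (f : ℕ → ℕ) : (enc x z n f).count z = n :=
  count_concat_append_singleton fun t => by simp [h.symm]

theorem count_enc_left (h : x ≠ z) (n : ℕ) (f : ℕ → ℕ) :
    (enc x z n f).count x = ∑ t ∈ Finset.range n, f t := by
  simp [enc, count_concat, count_append, h.symm]

theorem count_encPair (hxz : x ≠ z) (hyz : y ≠ z) (n : ℕ) (i j : ℕ → ℕ) :
    (encPair x y z n i j).count z = n :=
  count_concat_append_singleton fun t => by simp [hxz.symm, hyz.symm]

omit [DecidableEq A] in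
theorem le_of_enc_sublist (h : x ≠ z) {n : ℕ} {f g : ℕ → ℕ} (hfg : enc x z n f <+ enc x z n g) :
    ∀ t < n, f t ≤ g t := fun t ht =>
  have notMem_block (k : ℕ) : z ∉ replicate k x := by simp [h.symm]
  (replicate_sublist_replicate x).1 <|
    sublist_of_concat_sublist (r := []) (fun t => notMem_block (f t)) (fun t => notMem_block (g t))
      not_mem_nil (by simpa [enc] using hfg) t ht

omit [DecidableEq A] in
theorem enc_inj (h : x ≠ z) {n m : ℕ} {f g : ℕ → ℕ} (hfg : enc x z n f = enc x z m g) :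
    n = m ∧ ∀ t < n, f t = g t := by
  classical
  obtain rfl : n = m := by rw [← count_enc_right h n f, hfg, count_enc_right h]
  exact ⟨rfl, fun t ht => le_antisymm (le_of_enc_sublist h (by rw [hfg]) t ht)
    (le_of_enc_sublist h (by rw [hfg]) t ht)⟩

/-- The test for membership in `{x, y}`, used to project words to two letters. -/
def onPair (x y t : A) : Bool := decide (t = x ∨ t = y)

theorem onPair_comm (x y : A) : onPair x y = onPair y x := by
  funext t
  simp [onPair, or_comm]

theorem eq_of_filter_onPair {S : Set A} (hS : ∀ y ∈ S, ∃ x ∈ S, x ≠ y) {u v : List A}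
    (hu : ∀ y ∈ u, y ∈ S) (hv : ∀ y ∈ v, y ∈ S)
    (h : ∀ x ∈ S, ∀ y ∈ S, x ≠ y → u.filter (onPair x y) = v.filter (onPair x y)) : u = v := by
  induction u generalizing v with
  | nil =>
    rcases v with _ | ⟨y, v⟩
    · rfl
    · obtain ⟨x, hx, hxy⟩ := hS y (hv y (by simp))
      simpa [onPair] using h x hx y (hv y (by simp)) hxy
  | cons x u ih =>
    rcases v with _ | ⟨y, v⟩
    · obtain ⟨y, hy, hyx⟩ := hS x (hu x (by simp))
      simpa [onPair] using h y hy x (hu x (by simp)) hyx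
    obtain rfl : x = y := by
      by_contra hxy
      have := h x (hu x (by simp)) y (hv y (by simp)) hxy
      rw [filter_cons_of_pos (by simp [onPair]), filter_cons_of_pos (by simp [onPair])] at this
      exact hxy (cons.inj this).1
    refine congrArg _ (ih (fun y hy => hu y (by simp [hy])) (fun y hy => hv y (by simp [hy])) ?_)
    intro a ha b hb hab
    have := h a ha b hb hab
    rw [filter_cons, filter_cons] at this
    split_ifs at this
    · exact (cons.inj this).2
    · exact this

theorem filter_encPair_left (hxy : x ≠ y) (hyz : y ≠ z) (n : ℕ) (i j : ℕ → ℕ) :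
    (encPair x y z n i j).filter (onPair x z) = enc x z n i := by
  rw [encPair, filter_concat]
  exact concat_congr fun t _ => by simp [onPair, hxy.symm, hyz]

theorem filter_encPair_right (hxy : x ≠ y) (hxz : x ≠ z) (n : ℕ) (i j : ℕ → ℕ) :
    (encPair x y z n i j).filter (onPair y z) = enc y z n j := by
  rw [encPair, filter_concat]
  exact concat_congr fun t _ => by simp [onPair, hxy, hxz]

theorem filter_encPair_blocks (hxz : x ≠ z) (hyz : y ≠ z) (n : ℕ) (i j : ℕ → ℕ) :
    (encPair x y z n i j).filter (onPair x y) =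
      concat n fun t => replicate (i t) x ++ replicate (j t) y := by
  rw [encPair, filter_concat]
  exact concat_congr fun t _ => by simp [onPair, hxz.symm, hyz.symm]

theorem eq_encPair_of_filter (hxy : x ≠ y) (hxz : x ≠ z) (hyz : y ≠ z) {n : ℕ} {i j : ℕ → ℕ}
    {w : List A} (hw : ∀ t ∈ w, t ∈ ({x, y, z} : Set A))
    (hleft : w.filter (onPair x z) = enc x z n i) (hright : w.filter (onPair y z) = enc y z n j)
    (hblocks : w.filter (onPair x y) = concat n fun t => replicate (i t) x ++ replicate (j t) y) :
    w = encPair x y z n i j := by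
  rw [← filter_encPair_left hxy hyz n i j] at hleft
  rw [← filter_encPair_right hxy hxz n i j] at hright
  rw [← filter_encPair_blocks hxz hyz n i j] at hblocks
  refine eq_of_filter_onPair (S := {x, y, z}) ?_ hw mem_triple_of_mem_encPair ?_
  · rintro t (rfl | rfl | rfl)
    · exact ⟨y, by simp, hxy.symm⟩
    · exact ⟨x, by simp, hxy⟩
    · exact ⟨x, by simp, hxz⟩
  · rintro s (rfl | rfl | rfl) t (rfl | rfl | rfl) hst <;>
      first
      | exact absurd rfl hst
      | assumption
      | rw [onPair_comm]; assumption

/-- The three projections of `w` are powers whose exponents agree by counting letters. -/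
theorem exists_eq_encPair_const_iff (hxy : x ≠ y) (hxz : x ≠ z) (hyz : y ≠ z) (w : List A) :
    (∃ n N M, 0 < N ∧ 0 < M ∧ w = encPair x y z n (fun _ => N) fun _ => M) ↔
      (∀ t ∈ w, t ∈ ({x, y, z} : Set A)) ∧ ∃ p₁ p₂ p₃,
      (∃ q, q = w.filter (onPair x z) ∧
        ∃ n N, p₁ = replicate N x ++ [z] ∧ q = enc x z n fun _ => N) ∧
      (∃ q, q = w.filter (onPair y z) ∧
        ∃ n M, p₂ = replicate M y ++ [z] ∧ q = enc y z n fun _ => M) ∧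
      (∃ q, q = w.filter (onPair x y) ∧ ∃ n N M, 0 < N ∧ 0 < M ∧
        p₃ = replicate N x ++ replicate M y ∧ q = concat n fun _ => p₃) ∧
      p₃.count x = p₁.count x ∧ p₃.count y = p₂.count y := by
  constructor
  · rintro ⟨n, N, M, hN, hM, rfl⟩
    refine ⟨mem_triple_of_mem_encPair, _, _, _,
      ⟨_, rfl, n, N, rfl, filter_encPair_left hxy hyz ..⟩,
      ⟨_, rfl, n, M, rfl, filter_encPair_right hxy hxz ..⟩,
      ⟨_, rfl, n, N, M, hN, hM, rfl, filter_encPair_blocks hxz hyz ..⟩, ?_, ?_⟩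
    · simp [count_append, count_replicate, hxy.symm, hxz.symm]
    · simp [count_append, count_replicate, hxy, hyz.symm]
  · rintro ⟨hw, _, _, _, ⟨_, rfl, n, N', rfl, hleft⟩, ⟨_, rfl, n', M', rfl, hright⟩,
      ⟨_, rfl, k, N, M, hN, hM, rfl, hblocks⟩, hcount₁, hcount₂⟩
    obtain rfl : N = N' := by
      simpa [count_append, count_replicate, hxy.symm, hxz.symm] using hcount₁
    obtain rfl : M = M' := by
      simpa [count_append, count_replicate, hxy, hyz.symm] using hcount₂
    have hn : w.count z = n := by
      rw [← count_enc_right hxz n fun _ => N, ← hleft, count_filter (by simp [onPair])]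
    have hn' : w.count z = n' := by
      rw [← count_enc_right hyz n' fun _ => M, ← hright, count_filter (by simp [onPair])]
    have hnN : w.count x = n * N := by
      rw [← count_filter (p := onPair x z) (by simp [onPair]), hleft, count_enc_left hxz]
      simp
    have hkN : w.count x = k * N := by
      rw [← count_filter (p := onPair x y) (by simp [onPair]), hblocks, count_concat]
      simp [count_append, count_replicate, hxy.symm]
    obtain rfl : k = n := Nat.eq_of_mul_eq_mul_right hN (hkN.symm.trans hnN)
    obtain rfl : n' = k := hn'.symm.trans hn
    exact ⟨n', N, M, hN, hM, eq_encPair_of_filter hxy hxz hyz hw hleft hright hblocks⟩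

theorem exists_eq_encPair_iff (hxz : x ≠ z) (hyz : y ≠ z) (w : List A) :
    (∃ n i j, w = encPair x y z n i j) ↔
      ∃ q, (∃ n N M, 0 < N ∧ 0 < M ∧ q = encPair x y z n (fun _ => N) fun _ => M) ∧
        w <+ q ∧ w.count z = q.count z := by
  constructor
  · rintro ⟨n, i, j, rfl⟩
    have le_sum_succ (f : ℕ → ℕ) {t : ℕ} (ht : t < n) : f t ≤ ∑ s ∈ Finset.range n, f s + 1 :=
      (Finset.single_le_sum (fun _ _ => Nat.zero_le _) (Finset.mem_range.2 ht)).trans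
        (Nat.le_succ _)
    refine ⟨_, ⟨n, ∑ s ∈ Finset.range n, i s + 1, ∑ s ∈ Finset.range n, j s + 1,
      Nat.succ_pos _, Nat.succ_pos _, rfl⟩, concat_sublist fun t ht => ?_, ?_⟩
    · exact (sublist_replicate_append_replicate_iff.2
        ⟨_, le_sum_succ i ht, _, le_sum_succ j ht, rfl⟩).append (Sublist.refl _)
    · rw [count_encPair hxz hyz, count_encPair hxz hyz]
  · rintro ⟨_, ⟨n, N, M, -, -, rfl⟩, hw, hcount⟩
    rw [count_encPair hxz hyz] at hcount
    obtain ⟨s, rfl, hs⟩ := exists_eq_concat_of_sublist (by simp [hxz.symm, hyz.symm]) hw hcount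
    choose i _ j _ hij using fun t => sublist_replicate_append_replicate_iff.1 (hs t)
    exact ⟨n, i, j, by simp only [hij, encPair]⟩

end Enc

namespace Definable

variable {A : Type u} [Finite A] {α : Type} {x y z : A}

theorem exists_pos_eq_replicate_append_replicate (hxy : x ≠ y) (i : α) :
    Definable fun v : α → List A =>
      ∃ N M, 0 < N ∧ 0 < M ∧ v i = replicate N x ++ replicate M y :=
  ((forall_mem _ _).and <| (const_sublist _ _).and <| (const_sublist _ _).and
    (not_const_sublist _ _)).congr fun _ => exists_pos_eq_replicate_append_replicate_iff hxy _

theorem exists_eq_enc (hxy : x ≠ y) (hyz : y ≠ z) (i : α) :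
    Definable fun v : α → List A => ∃ n f, v i = enc x z n f :=
  have := nontrivial_of_ne x y hxy
  ((eq_const _ _).or <| ex <| (forall_mem _ _).and <| ex <| (eq_const _ _).and
    (append _ _ _ _)).congr fun _ => exists_eq_enc_iff hxy hyz _

theorem exists_eq_replicate_append_and_eq_enc_const (hxy : x ≠ y) (hxz : x ≠ z) (hyz : y ≠ z)
    (i j : α) :
    Definable fun v : α → List A =>
      ∃ n N, v i = replicate N x ++ [z] ∧ v j = enc x z n fun _ => N :=
  have := nontrivial_of_ne x y hxy
  ((exists_eq_replicate_append_cons hxz _ _).and (append_comm _ _ _)).congr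
    fun _ => exists_eq_replicate_append_and_eq_enc_const_iff hxy hxz hyz _ _

theorem exists_eq_enc_const (hxy : x ≠ y) (hxz : x ≠ z) (hyz : y ≠ z) (m : ℕ) (i : α) :
    Definable fun v : α → List A => ∃ n, v i = enc x z n fun _ => m :=
  (ex (P := fun v p => p = replicate m x ++ [z] ∧
      ∃ n N, p = replicate N x ++ [z] ∧ v i = enc x z n fun _ => N) <|
    (eq_const _ _).and (exists_eq_replicate_append_and_eq_enc_const hxy hxz hyz _ _)).congr
    fun v => by simp [replicate_inj]

theorem exists_eq_concat_const_blocks (hxy : x ≠ y) (hxz : x ≠ z) (hyz : y ≠ z) (i j : α) :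
    Definable fun v : α → List A => ∃ n N M, 0 < N ∧ 0 < M ∧
      v i = replicate N x ++ replicate M y ∧ v j = concat n fun _ => v i := by
  have := nontrivial_of_ne x y hxy
  refine ((exists_pos_eq_replicate_append_replicate hxy i).and (append_comm z i j)).congr
    fun v => ?_
  constructor
  · rintro ⟨n, N, M, hN, hM, hi, hj⟩
    have hz : z ∉ v i := by simp [hi, hxz.symm, hyz.symm]
    rw [hj]
    exact ⟨⟨N, M, hN, hM, hi⟩, hz, by simp [mem_concat, hz], append_concat_comm _ _⟩
  · rintro ⟨⟨N, M, hN, hM, hi⟩, -, -, h⟩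
    have hprim : IsPrimitive (v i) := hi ▸ isPrimitive_replicate_append_replicate hxy hN hM
    obtain ⟨n, hn⟩ := (hprim.append_comm_iff _).1 h
    exact ⟨n, N, M, hN, hM, hi, hn⟩

theorem exists_eq_encPair_const (hxy : x ≠ y) (hxz : x ≠ z) (hyz : y ≠ z) (i : α) :
    Definable fun v : α → List A =>
      ∃ n N M, 0 < N ∧ 0 < M ∧ v i = encPair x y z n (fun _ => N) fun _ => M := by
  classical
  have := nontrivial_of_ne x y hxy
  exact ((forall_mem _ _).and <| ex <| ex <| ex <|
    (ex <| (filter _ _ _).and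
      (exists_eq_replicate_append_and_eq_enc_const hxy hxz hyz _ _)).and <|
    (ex <| (filter _ _ _).and
      (exists_eq_replicate_append_and_eq_enc_const hxy.symm hyz hxz _ _)).and <|
    (ex <| (filter _ _ _).and (exists_eq_concat_const_blocks hxy hxz hyz _ _)).and <|
    (count_eq_count _ _ _).and (count_eq_count _ _ _)).congr
      fun _ => exists_eq_encPair_const_iff hxy hxz hyz _

theorem exists_eq_encPair (hxy : x ≠ y) (hxz : x ≠ z) (hyz : y ≠ z) (i : α) :
    Definable fun v : α → List A => ∃ n f g, v i = encPair x y z n f g := by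
  classical
  have := nontrivial_of_ne x y hxy
  exact (ex <| (exists_eq_encPair_const hxy hxz hyz _).and <| (sublist _ _).and
    (count_eq_count _ _ _)).congr fun _ => exists_eq_encPair_iff hxz hyz _

end Definable

section Arithmetic

variable {A : Type u} {a b c : A}

theorem encPair_sublist_iff {n : ℕ} {i j k : ℕ → ℕ} (hab : a ≠ b) (hac : a ≠ c) (hbc : b ≠ c) :
    encPair c a b n i j <+ (concat n fun t => (concat (k t) fun _ => [a, c]) ++ [b]) ++ [a, c] ↔
      ∀ t < n, i t + j t ≤ k t := by
  classical
  have block_sublist_iff (i j k : ℕ) :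
      (replicate i c ++ replicate j a <+ concat k fun _ => [a, c]) ↔ i + j ≤ k := by
    constructor
    · intro h
      induction k generalizing i with
      | zero => simpa using h
      | succ k ih =>
        rcases i with _ | i
        · simpa [count_concat, hac.symm] using h.count_le a
        · rw [concat_succ', replicate_succ] at h
          have := ih i (by simpa using h.of_cons_of_ne hac.symm)
          omega
    · intro h
      obtain ⟨l, rfl⟩ := Nat.exists_eq_add_of_le h
      rw [add_assoc, concat_add]
      refine Sublist.append ?_ ?_ <;> rw [replicate_sublist_iff, count_concat] <;>
        simp [hac, hac.symm]
  constructor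
  · intro h t ht
    refine (block_sublist_iff _ _ _).1 (sublist_of_concat_sublist ?_ ?_ ?_ h t ht)
    · simp [hab.symm, hbc]
    · simp [mem_concat, hab.symm, hbc]
    · simp [hab.symm, hbc]
  · exact fun h => (concat_sublist fun t ht => ((block_sublist_iff _ _ _).2 (h t ht)).append
      (Sublist.refl _)).trans (sublist_append_left _ _)

theorem encPair_eq_encPair_swap_iff {n : ℕ} {f g : ℕ → ℕ} (hab : a ≠ b) (hac : a ≠ c)
    (hbc : b ≠ c) :
    (∃ m i j, encPair c a b n g f = encPair a c b m i j) ↔ ∀ t < n, f t = 0 ∨ g t = 0 := by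
  classical
  constructor
  · rintro ⟨m, i, j, h⟩ t ht
    obtain rfl : n = m := by
      rw [← count_encPair hbc.symm hab n g f, h, count_encPair hab hbc.symm]
    have hblock : replicate (g t) c ++ replicate (f t) a <+
        replicate (i t) a ++ replicate (j t) c := by
      have h : encPair c a b n g f <+ encPair a c b n i j ++ [] := by simp [h]
      refine sublist_of_concat_sublist ?_ ?_ not_mem_nil h t ht <;> simp [hab.symm, hbc]
    by_contra! hne
    refine not_sublist_replicate_append hac (i t) (j t) (Sublist.trans ?_ hblock)
    exact (singleton_sublist.2 (by simp [hne.2])).append (l₁ := [c])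
      (singleton_sublist.2 (by simp [hne.1]))
  · intro h
    refine ⟨n, f, g, concat_congr fun t ht => ?_⟩
    rcases h t ht with h | h <;> simp [h]

variable [DecidableEq A]

/-- The substitution `a ↦ ac`, as a map from letters to words. -/
def double (a c t : A) : List A := if t = a then [a, c] else [t]

theorem flatMap_double_replicate (hab : a ≠ b) (n : ℕ) :
    (replicate n b).flatMap (double a c) = replicate n b := by
  induction n with
  | zero => rfl
  | succ n ih => simp [replicate_succ, ih, double, hab.symm]

theorem flatMap_double_replicate_self (a c : A) (n : ℕ) :
    (replicate n a).flatMap (double a c) = concat n fun _ => [a, c] := by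
  induction n with
  | zero => rfl
  | succ n ih => simp [replicate_succ, ih, double, concat_succ']

theorem flatMap_double_enc_left (hab : a ≠ b) (n : ℕ) (f : ℕ → ℕ) :
    (enc a b n f ++ [a]).flatMap (double a c) =
      (concat n fun t => (concat (f t) fun _ => [a, c]) ++ [b]) ++ [a, c] := by
  rw [flatMap_append, enc, flatMap_concat]
  simp only [flatMap_append, flatMap_double_replicate_self]
  simp [double, hab.symm]

theorem flatMap_double_enc_right (hab : a ≠ b) (n : ℕ) (f : ℕ → ℕ) :
    (enc b a n f).flatMap (double a c) = encPair b a c n f fun _ => 1 := by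
  rw [enc, flatMap_concat, encPair]
  simp only [flatMap_append, flatMap_double_replicate hab]
  simp [double]

/-- Each letter `a` closes a block of `X ++ [a] ∈ (b*a)*`, so its image under `a ↦ ac` is the word
of `(b*a*c)*` that projects to `X ++ [a]` on `{a, b}` and to a power of `ac` on `{a, c}`. -/
theorem eq_flatMap_double_iff (hab : a ≠ b) (hac : a ≠ c) (hbc : b ≠ c) (X Y : List A) :
    ((∀ y ∈ X, y ∈ ({b, a} : Set A)) ∧ Y = (X ++ [a]).flatMap (double a c)) ↔
      (∀ y ∈ X, y ∈ ({b, a} : Set A)) ∧ (∃ n i j, Y = encPair b a c n i j) ∧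
      (∃ p, p = [a] ∧ ∃ E, (c ∉ X ∧ c ∉ p ∧ E = X ++ p) ∧ E = Y.filter (onPair b a)) ∧
      ∃ P, P = Y.filter (onPair a c) ∧ ∃ n, P = enc a c n fun _ => 1 := by
  refine and_congr_right fun hX => ?_
  obtain ⟨n, f, hf⟩ := exists_append_singleton_eq_enc hX
  have filter_encPair (n : ℕ) (i : ℕ → ℕ) :
      (encPair b a c n i fun _ => 1).filter (onPair b a) = enc b a n i :=
    filter_encPair_blocks hbc hac ..
  constructor
  · rintro rfl
    have hc : c ∉ X := fun hc => (hX c hc).elim hbc.symm hac.symm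
    rw [hf, flatMap_double_enc_right hab]
    exact ⟨⟨_, _, _, rfl⟩, ⟨_, rfl, _, ⟨hc, by simp [hac.symm], rfl⟩, by rw [hf, filter_encPair]⟩,
      _, rfl, _, filter_encPair_right hab.symm hbc ..⟩
  · rintro ⟨⟨m, i, j, rfl⟩, ⟨_, rfl, _, ⟨-, -, rfl⟩, hE⟩, _, rfl, k, hP⟩
    rw [filter_encPair_right hab.symm hbc] at hP
    obtain ⟨rfl, hj⟩ := enc_inj hac hP
    have hY : encPair b a c m i j = encPair b a c m i fun _ => 1 :=
      concat_congr fun t ht => by rw [hj t ht]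
    rw [hY, hE, hY, filter_encPair, flatMap_double_enc_right hab]

theorem exists_eq_enc_and_eq_enc_iff (hab : a ≠ b) (hac : a ≠ c) (X Y : List A) :
    (∃ n f, X = enc a b n f ∧ Y = enc c b n f) ↔
      (∃ n f, X = enc a b n f) ∧
      ∃ D, ((∀ y ∈ X, y ∈ ({b, a} : Set A)) ∧ D = (X ++ [a]).flatMap (double a c)) ∧
      ∃ p, p = [c] ∧ ∃ E, (a ∉ Y ∧ a ∉ p ∧ E = Y ++ p) ∧ E = D.filter (onPair c b) := by
  have filter_double (n : ℕ) (f : ℕ → ℕ) :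
      ((enc a b n f ++ [a]).flatMap (double a c)).filter (onPair c b) = enc c b n f ++ [c] := by
    rw [flatMap_double_enc_left hab, filter_append, filter_concat, enc]
    congr 1
    · refine concat_congr fun t _ => ?_
      have power (m : ℕ) : (concat m fun _ => [c]) = replicate m c := by
        induction m with
        | zero => rfl
        | succ m ih => rw [concat_succ', ih]; rfl
      simp [filter_concat, onPair, hab, hac, power]
    · simp [onPair, hab, hac]
  constructor
  · rintro ⟨n, f, rfl, rfl⟩
    exact ⟨⟨n, f, rfl⟩, _, ⟨fun y hy => (mem_pair_of_mem_enc y hy).symm, rfl⟩, _, rfl, _,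
      ⟨notMem_enc hac.symm hab, by simp [hac], rfl⟩, (filter_double n f).symm⟩
  · rintro ⟨⟨n, f, rfl⟩, _, ⟨-, rfl⟩, _, rfl, _, ⟨-, -, rfl⟩, hY⟩
    exact ⟨n, f, rfl, append_cancel_right (hY.trans (filter_double n f))⟩

theorem exists_eq_enc_and_eq_enc_and_eq_encPair_iff (hab : a ≠ b) (hac : a ≠ c) (hbc : b ≠ c)
    (X Y S : List A) :
    (∃ n f g, X = enc a b n f ∧ Y = enc a b n g ∧ S = encPair c a b n g f) ↔
      (∃ n i j, S = encPair c a b n i j) ∧ X = S.filter (onPair a b) ∧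
      ∃ Y', (∃ n g, Y = enc a b n g ∧ Y' = enc c b n g) ∧ Y' = S.filter (onPair c b) := by
  constructor
  · rintro ⟨n, f, g, rfl, rfl, rfl⟩
    exact ⟨⟨n, g, f, rfl⟩, (filter_encPair_right hac.symm hbc.symm ..).symm, _, ⟨n, g, rfl, rfl⟩,
      (filter_encPair_left hac.symm hab ..).symm⟩
  · rintro ⟨⟨n, i, j, rfl⟩, rfl, _, ⟨m, g, rfl, rfl⟩, hY⟩
    rw [filter_encPair_left hac.symm hab] at hY
    obtain ⟨rfl, hg⟩ := enc_inj hbc.symm hY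
    exact ⟨m, j, i, filter_encPair_right hac.symm hbc.symm .., enc_congr hg, rfl⟩

/-- The subword test gives `f t + g t ≤ h t`, and counting `a` turns this into an equality. -/
theorem exists_eq_enc_add_iff (hab : a ≠ b) (hac : a ≠ c) (hbc : b ≠ c) (X Y Z : List A) :
    (∃ n f g, X = enc a b n f ∧ Y = enc a b n g ∧ Z = enc a b n fun t => f t + g t) ↔
      (∃ n h, Z = enc a b n h) ∧
      ∃ S, (∃ n f g, X = enc a b n f ∧ Y = enc a b n g ∧ S = encPair c a b n g f) ∧
      S.count b = Z.count b ∧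
      (∃ D, ((∀ y ∈ Z, y ∈ ({b, a} : Set A)) ∧ D = (Z ++ [a]).flatMap (double a c)) ∧ S <+ D) ∧
      ∃ W, (c ∉ X ∧ c ∉ Y ∧ W = X ++ Y) ∧ W.count a = Z.count a := by
  have count_append_eq_iff (n : ℕ) (f g h : ℕ → ℕ) :
      (enc a b n f ++ enc a b n g).count a = (enc a b n h).count a ↔
        ∑ t ∈ Finset.range n, (g t + f t) = ∑ t ∈ Finset.range n, h t := by
    rw [count_append, count_enc_left hab, count_enc_left hab, count_enc_left hab, add_comm,
      Finset.sum_add_distrib]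
  constructor
  · rintro ⟨n, f, g, rfl, rfl, rfl⟩
    refine ⟨⟨n, _, rfl⟩, _, ⟨n, f, g, rfl, rfl, rfl⟩, ?_,
      ⟨_, ⟨fun y hy => (mem_pair_of_mem_enc y hy).symm, rfl⟩, ?_⟩, _,
      ⟨notMem_enc hac hbc.symm, notMem_enc hac hbc.symm, rfl⟩, ?_⟩
    · rw [count_encPair hbc.symm hab, count_enc_right hab]
    · rw [flatMap_double_enc_left hab, encPair_sublist_iff hab hac hbc]
      exact fun t _ => (add_comm _ _).le
    · rw [count_append_eq_iff]
      exact Finset.sum_congr rfl fun t _ => add_comm _ _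
  · rintro ⟨⟨m, h, rfl⟩, _, ⟨n, f, g, rfl, rfl, rfl⟩, hcount, ⟨_, ⟨-, rfl⟩, hsub⟩, _, ⟨-, -, rfl⟩,
      hsum⟩
    rw [count_encPair hbc.symm hab, count_enc_right hab] at hcount
    subst hcount
    rw [flatMap_double_enc_left hab, encPair_sublist_iff hab hac hbc] at hsub
    have heq := (Finset.sum_eq_sum_iff_of_le fun t ht => hsub t (Finset.mem_range.1 ht)).1
      ((count_append_eq_iff n f g h).1 hsum)
    refine ⟨n, f, g, rfl, rfl, enc_congr fun t ht => ?_⟩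
    rw [← heq t (Finset.mem_range.2 ht), add_comm]

omit [DecidableEq A] in
theorem exists_eq_enc_disjoint_iff (hab : a ≠ b) (hac : a ≠ c) (hbc : b ≠ c) (X Y : List A) :
    (∃ n f g, X = enc a b n f ∧ Y = enc a b n g ∧ ∀ t < n, f t = 0 ∨ g t = 0) ↔
      ∃ S, (∃ n f g, X = enc a b n f ∧ Y = enc a b n g ∧ S = encPair c a b n g f) ∧
        ∃ n i j, S = encPair a c b n i j := by
  constructor
  · rintro ⟨n, f, g, rfl, rfl, h⟩
    exact ⟨_, ⟨n, f, g, rfl, rfl, rfl⟩, (encPair_eq_encPair_swap_iff hab hac hbc).2 h⟩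
  · rintro ⟨_, ⟨n, f, g, rfl, rfl, rfl⟩, h⟩
    exact ⟨n, f, g, rfl, rfl, (encPair_eq_encPair_swap_iff hab hac hbc).1 h⟩

end Arithmetic

namespace Definable

variable {A : Type u} [Finite A] {α : Type} {a b c : A}

theorem eq_flatMap_double [DecidableEq A] (hab : a ≠ b) (hac : a ≠ c) (hbc : b ≠ c) (i j : α) :
    Definable fun v : α → List A =>
      (∀ y ∈ v i, y ∈ ({b, a} : Set A)) ∧ v j = (v i ++ [a]).flatMap (double a c) :=
  have := nontrivial_of_ne a b hab
  ((forall_mem _ _).and <| (exists_eq_encPair hab.symm hbc hac _).and <|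
    (ex <| (eq_const _ _).and <| ex <| (append _ _ _ _).and (filter _ _ _)).and <|
    ex <| (filter _ _ _).and (exists_eq_enc_const hab hac hbc _ _)).congr
      fun _ => eq_flatMap_double_iff hab hac hbc _ _

theorem exists_eq_enc_and_eq_enc (hab : a ≠ b) (hac : a ≠ c) (hbc : b ≠ c) (i j : α) :
    Definable fun v : α → List A => ∃ n f, v i = enc a b n f ∧ v j = enc c b n f := by
  classical
  have := nontrivial_of_ne a b hab
  exact ((exists_eq_enc hac hbc.symm _).and <| ex <| (eq_flatMap_double hab hac hbc _ _).and <|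
    ex <| (eq_const _ _).and <| ex <| (append _ _ _ _).and (filter _ _ _)).congr
      fun _ => exists_eq_enc_and_eq_enc_iff hab hac _ _

theorem exists_eq_enc_and_eq_enc_and_eq_encPair (hab : a ≠ b) (hac : a ≠ c) (hbc : b ≠ c)
    (i j k : α) :
    Definable fun v : α → List A =>
      ∃ n f g, v i = enc a b n f ∧ v j = enc a b n g ∧ v k = encPair c a b n g f := by
  classical
  have := nontrivial_of_ne a b hab
  exact ((exists_eq_encPair hac.symm hbc.symm hab _).and <| (filter _ _ _).and <|
    ex <| (exists_eq_enc_and_eq_enc hab hac hbc _ _).and (filter _ _ _)).congr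
      fun _ => exists_eq_enc_and_eq_enc_and_eq_encPair_iff hab hac hbc _ _ _

theorem exists_eq_enc_add (hab : a ≠ b) (hac : a ≠ c) (hbc : b ≠ c) (i j k : α) :
    Definable fun v : α → List A =>
      ∃ n f g, v i = enc a b n f ∧ v j = enc a b n g ∧ v k = enc a b n fun t => f t + g t := by
  classical
  have := nontrivial_of_ne a b hab
  exact ((exists_eq_enc hac hbc.symm _).and <|
    ex <| (exists_eq_enc_and_eq_enc_and_eq_encPair hab hac hbc _ _ _).and <|
    (count_eq_count _ _ _).and <| (ex <| (eq_flatMap_double hab hac hbc _ _).and <|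
    sublist _ _).and <| ex <| (append _ _ _ _).and (count_eq_count _ _ _)).congr
      fun _ => exists_eq_enc_add_iff hab hac hbc _ _ _

theorem exists_eq_enc_disjoint (hab : a ≠ b) (hac : a ≠ c) (hbc : b ≠ c) (i j : α) :
    Definable fun v : α → List A =>
      ∃ n f g, v i = enc a b n f ∧ v j = enc a b n g ∧ ∀ t < n, f t = 0 ∨ g t = 0 :=
  (ex <| (exists_eq_enc_and_eq_enc_and_eq_encPair hab hac hbc _ _ _).and <|
    exists_eq_encPair hac hab hbc.symm _).congr
      fun _ => exists_eq_enc_disjoint_iff hab hac hbc _ _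

end Definable

/-- The letters `a`, `b` and `c` are distinct. -/
structure Distinct {A : Type u} (a b c : A) : Prop where
  ab : a ≠ b
  ac : a ≠ c
  bc : b ≠ c

section Lift

variable {A : Type u} {ι : Type}

/-- A family of words codes sequences of equal length whose entries satisfy `R` pointwise. -/
def Lift (a b : A) (R : (ι → ℕ) → Prop) (v : ι → List A) : Prop :=
  ∃ (n : ℕ) (x : ι → ℕ → ℕ), (∀ t < n, R fun i => x i t) ∧ ∀ i, v i = enc a b n (x i)

/-- The pointwise lift of `R` to sequences is definable. -/
def LiftDefinable (a b : A) (R : (ι → ℕ) → Prop) : Prop :=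
  Definable (Lift a b R)

theorem lift_enc_iff [Nonempty ι] {a b : A} (hab : a ≠ b) (R : (ι → ℕ) → Prop) (n : ℕ)
    (x : ι → ℕ → ℕ) :
    Lift a b R (fun i => enc a b n (x i)) ↔ ∀ t < n, R fun i => x i t := by
  constructor
  · rintro ⟨m, y, h, he⟩ t ht
    obtain ⟨rfl, -⟩ := enc_inj hab (he (Classical.arbitrary ι))
    convert h t ht using 2 with i
    exact (enc_inj hab (he i)).2 t ht
  · exact fun h => ⟨n, x, h, fun _ => rfl⟩

theorem lift_true_iff [DecidableEq A] {a b : A} (hab : a ≠ b) (i₀ : ι) (v : ι → List A) :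
    Lift a b (fun _ => True) v ↔
      ∀ i, (∃ n f, v i = enc a b n f) ∧ (v i).count b = (v i₀).count b := by
  constructor
  · rintro ⟨n, x, -, h⟩ i
    exact ⟨⟨n, _, h i⟩, by rw [h, h, count_enc_right hab, count_enc_right hab]⟩
  · intro h
    choose n x hx using fun i => (h i).1
    refine ⟨n i₀, x, fun _ _ => trivial, fun i => ?_⟩
    have := (h i).2
    rw [hx, hx, count_enc_right hab, count_enc_right hab] at this
    rw [hx, this]

end Lift

namespace LiftDefinable

variable {A : Type u} {ι κ : Type} {a b c : A}

theorem congr {R S : (ι → ℕ) → Prop} (h : LiftDefinable a b R) (H : ∀ x, S x ↔ R x) :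
    LiftDefinable a b S := by
  obtain rfl : S = R := funext fun x => propext (H x)
  exact h

theorem exs [Finite κ] {P : (ι → ℕ) → (κ → ℕ) → Prop}
    (h : LiftDefinable a b fun x : ι ⊕ κ → ℕ => P (fun i => x (.inl i)) fun i => x (.inr i)) :
    LiftDefinable a b fun x => ∃ y, P x y := by
  refine (Definable.exs (P := fun (v : ι → List A) (w : κ → List A) =>
    Lift a b (fun x : ι ⊕ κ → ℕ => P (fun i => x (.inl i)) fun i => x (.inr i))
      (Sum.elim v w)) ?_).congr fun v => ?_
  · refine Definable.congr h fun v => ?_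
    rw [show Sum.elim (fun i => v (.inl i)) (fun i => v (.inr i)) = v from Sum.elim_comp_inl_inr v]
  · constructor
    · rintro ⟨n, x, h, hv⟩
      choose! y hy using h
      exact ⟨fun k => enc a b n fun t => y t k, n, Sum.elim x fun k t => y t k, hy,
        Sum.rec hv fun _ => rfl⟩
    · rintro ⟨w, n, x, h, hv⟩
      exact ⟨n, fun i => x (.inl i), fun t ht => ⟨_, h t ht⟩, fun i => hv (.inl i)⟩

variable [Finite A] [Finite ι]

theorem true (hd : Distinct a b c) (i₀ : ι) : LiftDefinable a b fun _ : ι → ℕ => True := by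
  classical
  have := nontrivial_of_ne a b hd.ab
  exact (Definable.all fun _ => (Definable.exists_eq_enc hd.ac hd.bc.symm _).and
    (Definable.count_eq_count _ _ _)).congr fun v => lift_true_iff hd.ab i₀ v

theorem of_definable [Nonempty ι] (hd : Distinct a b c)
    {R : (ι → ℕ) → Prop} {Q : (ι → List A) → Prop} (hQ : Definable Q)
    (h : ∀ n (x : ι → ℕ → ℕ), Q (fun i => enc a b n (x i)) ↔ ∀ t < n, R fun i => x i t) :
    LiftDefinable a b R := by
  refine ((true hd (Classical.arbitrary ι)).and hQ).congr fun v => ?_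
  constructor
  · rintro ⟨n, x, hR, hv⟩
    obtain rfl : v = fun i => enc a b n (x i) := funext hv
    exact ⟨⟨n, x, fun _ _ => trivial, hv⟩, (h n x).2 hR⟩
  · rintro ⟨⟨n, x, -, hv⟩, hq⟩
    obtain rfl : v = fun i => enc a b n (x i) := funext hv
    exact ⟨n, x, (h n x).1 hq, hv⟩

theorem and [Nonempty ι] (hd : Distinct a b c) {R S : (ι → ℕ) → Prop}
    (hR : LiftDefinable a b R) (hS : LiftDefinable a b S) :
    LiftDefinable a b fun x => R x ∧ S x :=
  of_definable hd (Definable.and hR hS) fun n x => by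
    rw [lift_enc_iff hd.ab, lift_enc_iff hd.ab]
    exact ⟨fun h t ht => ⟨h.1 t ht, h.2 t ht⟩,
      fun h => ⟨fun t ht => (h t ht).1, fun t ht => (h t ht).2⟩⟩

theorem all [Nonempty ι] (hd : Distinct a b c) {β : Type} [Finite β]
    {R : β → (ι → ℕ) → Prop} (hR : ∀ k, LiftDefinable a b (R k)) :
    LiftDefinable a b fun x => ∀ k, R k x :=
  of_definable hd (Definable.all hR) fun n x => by
    simp only [lift_enc_iff hd.ab]
    exact ⟨fun h t ht k => h k t ht, fun h k t ht => h t ht k⟩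

theorem subst (hd : Distinct a b c) [Nonempty κ] {R : (κ → ℕ) → Prop}
    (hR : LiftDefinable a b R) (f : κ → ι) :
    LiftDefinable a b fun x : ι → ℕ => R fun k => x (f k) :=
  have : Nonempty ι := .map f inferInstance
  of_definable hd (Definable.subst hR f) fun n x => lift_enc_iff hd.ab R n fun k => x (f k)

theorem ex (hd : Distinct a b c) {P : (ι → ℕ) → ℕ → Prop}
    (h : LiftDefinable a b fun x : Option ι → ℕ => P (fun i => x (some i)) (x none)) :
    LiftDefinable a b fun x => ∃ y, P x y := by
  have := subst hd h (ι := ι ⊕ Unit) (fun o => o.elim (.inr ()) .inl)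
  refine (exs (P := fun v (w : Unit → ℕ) => P v (w ())) this).congr fun v => ?_
  exact ⟨fun ⟨x, h⟩ => ⟨fun _ => x, h⟩, fun ⟨w, h⟩ => ⟨w (), h⟩⟩

theorem eq (hd : Distinct a b c) (i j : ι) : LiftDefinable a b fun x : ι → ℕ => x i = x j :=
  have : Nonempty ι := ⟨i⟩
  of_definable hd (Definable.eq i j) fun _ _ => ⟨fun h => (enc_inj hd.ab h).2, enc_congr⟩

theorem const (hd : Distinct a b c) (m : ℕ) (i : ι) :
    LiftDefinable a b fun x : ι → ℕ => x i = m :=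
  have : Nonempty ι := ⟨i⟩
  of_definable hd (Definable.exists_eq_enc_const hd.ac hd.ab hd.bc.symm m i) fun n _ =>
    ⟨fun ⟨_, h⟩ => (enc_inj hd.ab h).2, fun h => ⟨n, enc_congr h⟩⟩

theorem add (hd : Distinct a b c) (k i j : ι) :
    LiftDefinable a b fun x : ι → ℕ => x k = x i + x j :=
  have : Nonempty ι := ⟨i⟩
  of_definable hd (Definable.exists_eq_enc_add hd.ab hd.ac hd.bc i j k) fun n x => by
    constructor
    · rintro ⟨m, f, g, h₁, h₂, h₃⟩ t ht
      obtain ⟨rfl, hf⟩ := enc_inj hd.ab h₁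
      beta_reduce
      rw [hf t ht, (enc_inj hd.ab h₂).2 t ht, (enc_inj hd.ab h₃).2 t ht]
    · exact fun h => ⟨n, _, _, rfl, rfl, enc_congr h⟩

theorem eq_zero_or_eq_zero (hd : Distinct a b c) (i j : ι) :
    LiftDefinable a b fun x : ι → ℕ => x i = 0 ∨ x j = 0 :=
  have : Nonempty ι := ⟨i⟩
  of_definable hd (Definable.exists_eq_enc_disjoint hd.ab hd.ac hd.bc i j) fun n x => by
    constructor
    · rintro ⟨m, f, g, h₁, h₂, h₃⟩ t ht
      obtain ⟨rfl, hf⟩ := enc_inj hd.ab h₁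
      beta_reduce
      rw [hf t ht, (enc_inj hd.ab h₂).2 t ht]
      exact h₃ t ht
    · exact fun h => ⟨n, _, _, rfl, rfl, h⟩

theorem add_eq_add (hd : Distinct a b c) (i j k l : ι) :
    LiftDefinable a b fun x : ι → ℕ => x i + x j = x k + x l :=
  (ex hd (P := fun x y => y = x i + x j ∧ y = x k + x l) <|
    and hd (add hd _ _ _) (add hd _ _ _)).congr fun x => by simp

theorem le (hd : Distinct a b c) (i j : ι) : LiftDefinable a b fun x : ι → ℕ => x i ≤ x j :=
  (ex hd (P := fun x y => x j = x i + y) <| add hd _ _ _).congr fun _ => le_iff_exists_add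

theorem succ (hd : Distinct a b c) (i j : ι) :
    LiftDefinable a b fun x : ι → ℕ => x i = x j + 1 :=
  (ex hd (P := fun x y => y = 1 ∧ x i = x j + y) <| and hd (const hd _ _) (add hd _ _ _)).congr
    fun _ => by simp

theorem eq_or_eq (hd : Distinct a b c) (i j k l : ι) :
    LiftDefinable a b fun x : ι → ℕ => x i = x j ∨ x k = x l := by
  have : Nonempty ι := ⟨i⟩
  refine (ex hd (P := fun x s => (∃ d e, x i + d = x j + e ∧ s = d + e) ∧
      ∃ s', (∃ d e, x k + d = x l + e ∧ s' = d + e) ∧ (s = 0 ∨ s' = 0)) <|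
    and hd (ex hd <| ex hd <| and hd (add_eq_add hd _ _ _ _) (add hd _ _ _)) <|
    ex hd <| and hd (ex hd <| ex hd <| and hd (add_eq_add hd _ _ _ _) (add hd _ _ _))
      (eq_zero_or_eq_zero hd _ _)).congr fun x => ?_
  constructor
  · rintro (h | h)
    · exact ⟨0, ⟨0, 0, by omega⟩, x k + x l, ⟨x l, x k, by omega⟩, .inl rfl⟩
    · exact ⟨x i + x j, ⟨x j, x i, by omega⟩, 0, ⟨0, 0, by omega⟩, .inr rfl⟩
  · rintro ⟨s, ⟨d, e, _⟩, s', ⟨d', e', _⟩, _⟩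
    omega

theorem ite (hd : Distinct a b c) (r i j p q : ι) :
    LiftDefinable a b fun x : ι → ℕ => x r = if x i < x j then x p else x q := by
  have : Nonempty ι := ⟨i⟩
  refine (and hd
    (ex hd (P := fun x y => (∃ s, y = x j + s) ∧ (x i = y ∨ x r = x p)) <|
      and hd (ex hd <| add hd _ _ _) (eq_or_eq hd _ _ _ _))
    (ex hd (P := fun x y => (∃ s z, z = x i + s ∧ y = z + 1) ∧ (x j = y ∨ x r = x q)) <|
      and hd (ex hd <| ex hd <| and hd (add hd _ _ _) (succ hd _ _))
        (eq_or_eq hd _ _ _ _))).congr fun x => ?_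
  rcases lt_or_ge (x i) (x j) with h | h
  · rw [if_pos h]
    refine ⟨fun hr => ⟨⟨x j, ⟨0, rfl⟩, .inr hr⟩, x j, ⟨x j - x i - 1, _, rfl, by omega⟩, .inl rfl⟩,
      ?_⟩
    rintro ⟨⟨_, ⟨s, rfl⟩, hi | hr⟩, -⟩
    · omega
    · exact hr
  · rw [if_neg h.not_gt]
    refine ⟨fun hr => ⟨⟨x i, ⟨x i - x j, by omega⟩, .inl rfl⟩, x i + 1, ⟨0, _, rfl, rfl⟩, .inr hr⟩,
      ?_⟩
    rintro ⟨-, _, ⟨s, _, rfl, rfl⟩, hj | hr⟩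
    · omega
    · exact hr

end LiftDefinable

section Iteration

variable {A : Type u} {α σ : Type} {a b c : A}

/-- Two sequences that agree up to a shift are the two ends of one sequence. -/
theorem enc_append_enc_eq_iff (hab : a ≠ b) {n m : ℕ} {f g f' g' : ℕ → ℕ} :
    enc a b n f ++ enc a b m g = enc a b m g' ++ enc a b n f' ↔
      ∃ s : ℕ → ℕ, (∀ t < n, f t = s t) ∧ (∀ t < m, g t = s (n + t)) ∧
        (∀ t < m, g' t = s t) ∧ ∀ t < n, f' t = s (m + t) := by
  have split_at (p q : ℕ) (x y : ℕ → ℕ) : enc a b p x ++ enc a b q y =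
      enc a b (p + q) fun t => if t < p then x t else y (t - p) := by
    rw [enc_add]
    congr 1
    · exact enc_congr fun t ht => (if_pos ht).symm
    · exact enc_congr fun t _ => by simp
  constructor
  · rw [split_at, split_at]
    intro h
    have h := (enc_inj hab h).2
    refine ⟨fun t => if t < n then f t else g (t - n), fun t ht => (if_pos ht).symm,
      fun t _ => by simp, fun t ht => ?_, fun t ht => ?_⟩
    · beta_reduce
      rw [h t (by omega), if_pos ht]
    · beta_reduce
      rw [h (m + t) (by omega), if_neg (by omega), Nat.add_sub_cancel_left]
  · rintro ⟨s, hf, hg, hg', hf'⟩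
    rw [enc_congr hf, enc_congr hg, enc_congr hg', enc_congr hf', ← enc_add, ← enc_add, add_comm]

/-- The pairs of families of words that code `n` states and the states reached from them by `T`
applications of `F`, the number `T` being the same for all of them. -/
def Iterates (a b : A) (F : (σ → ℕ) → σ → ℕ) (v : σ ⊕ σ → List A) : Prop :=
  ∃ (n T : ℕ) (x : ℕ → σ → ℕ), (∀ i, v (.inl i) = enc a b n fun j => x j i) ∧
    ∀ i, v (.inr i) = enc a b n fun j => F^[T] (x j) i

theorem iterate_eq_of_shift {F : (σ → ℕ) → σ → ℕ} {n T : ℕ} {s : σ → ℕ → ℕ}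
    (h : ∀ k < n * T, ∀ i, s i (n + k) = F (fun i => s i k) i) {j : ℕ} (hj : j < n) {t : ℕ}
    (ht : t ≤ T) : (fun i => s i (n * t + j)) = F^[t] fun i => s i j := by
  induction t with
  | zero => simp
  | succ t ih =>
    rw [Function.iterate_succ_apply', ← ih (by omega)]
    funext i
    rw [show n * (t + 1) + j = n + (n * t + j) by ring, h _ (by nlinarith)]

/-- The `n` orbits are written one state after the other into the long sequence whose entry
number `t * n + j` is `F^[t] (x j)`, so that applying `F` shifts it by `n` entries. -/
theorem iterates_iff [DecidableEq A] [Nonempty σ] (hd : Distinct a b c) (F : (σ → ℕ) → σ → ℕ)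
    (v : σ ⊕ σ → List A) :
    Iterates a b F v ↔ Lift a b (fun _ => True) v ∧
      ∃ w : σ ⊕ σ → List A, Lift a b (fun z => ∀ i, z (.inr i) = F (fun i => z (.inl i)) i) w ∧
      ∀ i, (∃ W, (c ∉ v (.inl i) ∧ c ∉ w (.inr i) ∧ W = v (.inl i) ++ w (.inr i)) ∧
        (c ∉ w (.inl i) ∧ c ∉ v (.inr i) ∧ W = w (.inl i) ++ v (.inr i))) ∧
      (v (.inl i)).count b ∣ (w (.inl i)).count b := by
  have hc {n f} : c ∉ enc a b n f := notMem_enc hd.ac hd.bc.symm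
  constructor
  · rintro ⟨n, T, x, hl, hr⟩
    refine ⟨⟨n, Sum.elim (fun i j => x j i) fun i j => F^[T] (x j) i, fun _ _ => trivial,
      Sum.rec hl hr⟩, Sum.elim (fun i => enc a b (n * T) fun k => F^[k / n] (x (k % n)) i)
        fun i => enc a b (n * T) fun k => F^[k / n + 1] (x (k % n)) i,
      ⟨n * T, Sum.elim (fun i k => F^[k / n] (x (k % n)) i) fun i k => F^[k / n + 1] (x (k % n)) i,
        fun k _ i => ?_, Sum.rec (fun _ => rfl) fun _ => rfl⟩, fun i => ?_⟩
    · simp only [Sum.elim_inl, Sum.elim_inr, Function.iterate_succ_apply']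
    · rw [hl, hr, Sum.elim_inl, Sum.elim_inr, count_enc_right hd.ab, count_enc_right hd.ab]
      refine ⟨⟨_, ⟨hc, hc, rfl⟩, hc, hc, (enc_append_enc_eq_iff hd.ab).2
        ⟨fun k => F^[k / n] (x (k % n)) i, fun t ht => ?_, fun t ht => ?_, fun _ _ => rfl,
          fun t ht => ?_⟩⟩, Dvd.intro _ rfl⟩
      · simp [Nat.div_eq_of_lt ht, Nat.mod_eq_of_lt ht]
      · beta_reduce
        rw [Nat.add_div_left _ (Nat.pos_of_mul_pos_right ht.pos), Nat.add_mod_left]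
      · beta_reduce
        rw [Nat.mul_add_div ht.pos, Nat.mul_add_mod, Nat.div_eq_of_lt ht, Nat.mod_eq_of_lt ht,
          add_zero]
  · rintro ⟨⟨n, x, -, hx⟩, w, ⟨M, y, hF, hy⟩, h⟩
    obtain ⟨T, rfl⟩ : n ∣ M := by
      have := (h (Classical.arbitrary σ)).2
      rwa [hx, hy, count_enc_right hd.ab, count_enc_right hd.ab] at this
    have shift (i : σ) : enc a b n (x (.inl i)) ++ enc a b (n * T) (y (.inr i)) =
        enc a b (n * T) (y (.inl i)) ++ enc a b n (x (.inr i)) := by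
      obtain ⟨W, ⟨-, -, h₁⟩, -, -, h₂⟩ := (h i).1
      rwa [h₁, hx, hx, hy, hy] at h₂
    choose s hs₁ hs₂ hs₃ hs₄ using fun i => (enc_append_enc_eq_iff hd.ab).1 (shift i)
    have hs (k) (hk : k < n * T) (i : σ) : s i (n + k) = F (fun i => s i k) i := by
      rw [← hs₂ i k hk]
      simpa only [hs₃ _ k hk] using hF k hk i
    refine ⟨n, T, fun j i => x (.inl i) j, fun i => hx _, fun i => (hx _).trans ?_⟩
    refine enc_congr fun j hj => (hs₄ i j hj).trans ?_
    simp only [hs₁ _ j hj]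
    exact congrFun (iterate_eq_of_shift hs hj le_rfl) i

variable [Finite A]

theorem Definable.count_dvd_count [DecidableEq A] (hd : Distinct a b c) (i j : α) :
    Definable fun v : α → List A => (v i).count b ∣ (v j).count b := by
  have := nontrivial_of_ne a b hd.ab
  refine (ex (P := fun v p => p.count b = (v i).count b ∧
    ∃ P, (∃ n N, p = replicate N b ++ [a] ∧ P = enc b a n fun _ => N) ∧
      P.count b = (v j).count b) <| (count_eq_count _ _ _).and <| ex <|
    (exists_eq_replicate_append_and_eq_enc_const hd.bc hd.ab.symm hd.ac.symm _ _).and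
      (count_eq_count _ _ _)).congr fun v => ?_
  have count_block (N : ℕ) : (replicate N b ++ [a]).count b = N := by simp [hd.ab]
  have count_enc_const (n N : ℕ) : (enc b a n fun _ => N).count b = N * n := by
    simp [count_enc_left hd.ab.symm, mul_comm]
  constructor
  · rintro ⟨n, hn⟩
    exact ⟨_, count_block _, _, ⟨n, _, rfl, rfl⟩, (count_enc_const n _).trans hn.symm⟩
  · rintro ⟨_, hi, _, ⟨n, N, rfl, rfl⟩, hj⟩
    rw [← hi, ← hj, count_block, count_enc_const]
    exact Dvd.intro _ rfl

theorem Definable.iterates [Finite σ] [Nonempty σ] (hd : Distinct a b c) {F : (σ → ℕ) → σ → ℕ}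
    (hF : LiftDefinable a b fun z : σ ⊕ σ → ℕ => ∀ i, z (.inr i) = F (fun i => z (.inl i)) i) :
    Definable (Iterates a b F) := by
  classical
  have := nontrivial_of_ne a b hd.ab
  exact (and (LiftDefinable.true hd (.inl (Classical.arbitrary σ))) <| exs <|
    (Definable.subst hF Sum.inr).and <| all fun _ =>
    (ex <| (append _ _ _ _).and (append _ _ _ _)).and (count_dvd_count hd _ _)).congr
      fun v => iterates_iff hd F v

/-- If `P x y` is preserved by `F`, then the maximum of the numbers of iterations that the entries
of a sequence require serves for all of them. -/
theorem LiftDefinable.exists_iterate [Finite σ] [Nonempty σ] (hd : Distinct a b c)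
    {F : (σ → ℕ) → σ → ℕ}
    (hF : LiftDefinable a b fun z : σ ⊕ σ → ℕ => ∀ i, z (.inr i) = F (fun i => z (.inl i)) i)
    {P : (α → ℕ) → (σ → ℕ) → (σ → ℕ) → Prop}
    (hP : LiftDefinable a b fun z : α ⊕ (σ ⊕ σ) → ℕ =>
      P (fun i => z (.inl i)) (fun i => z (.inr (.inl i))) fun i => z (.inr (.inr i)))
    (hPF : ∀ x y z, P x y z → P x y (F z)) :
    LiftDefinable a b fun x => ∃ y T, P x y (F^[T] y) := by
  have stable (x y) {T T' : ℕ} (hT : T ≤ T') (h : P x y (F^[T] y)) : P x y (F^[T'] y) := by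
    induction T', hT using Nat.le_induction with
    | base => exact h
    | succ T' _ ih =>
      rw [Function.iterate_succ_apply']
      exact hPF _ _ _ ih
  refine (Definable.exs (P := fun v w => Iterates a b F w ∧ Lift a b (fun z : α ⊕ (σ ⊕ σ) → ℕ =>
      P (fun i => z (.inl i)) (fun i => z (.inr (.inl i))) fun i => z (.inr (.inr i)))
      (Sum.elim v w)) <| ((Definable.iterates hd hF).subst _).and <|
    Definable.congr hP fun v => by
      rw [show Sum.elim (fun i => v (.inl i)) (fun i => v (.inr i)) = v from
        Sum.elim_comp_inl_inr v]).congr fun v => ?_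
  constructor
  · rintro ⟨n, x, h, hv⟩
    choose! y T hyT using h
    let T₀ := ∑ j ∈ Finset.range n, T j
    refine ⟨Sum.elim (fun i => enc a b n fun j => y j i) fun i => enc a b n fun j => F^[T₀] (y j) i,
      ⟨n, T₀, y, fun _ => rfl, fun _ => rfl⟩, n,
      Sum.elim x (Sum.elim (fun i j => y j i) fun i j => F^[T₀] (y j) i), fun j hj => ?_,
      Sum.rec hv (Sum.rec (fun _ => rfl) fun _ => rfl)⟩
    exact stable _ _ (Finset.single_le_sum (f := T) (by simp) (Finset.mem_range.2 hj)) (hyT j hj)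
  · rintro ⟨w, ⟨m, T, y, hl, hr⟩, n, x, hx, hv⟩
    have hinl i := enc_inj hd.ab ((hv (.inr (.inl i))).symm.trans (hl i))
    have hinr i := enc_inj hd.ab ((hv (.inr (.inr i))).symm.trans (hr i))
    refine ⟨n, fun i => x (.inl i), fun j hj => ⟨y j, T, ?_⟩, fun i => hv (.inl i)⟩
    convert hx j hj using 2
    · exact ((hinl _).2 j hj).symm
    · exact ((hinr _).2 j hj).symm

end Iteration

/-- The graph of `f` lifts to definable relations between sequences. -/
def FunDefinable {A : Type u} (a b : A) {n : ℕ} (f : List.Vector ℕ n → ℕ) : Prop :=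
  ∀ {ι : Type} [Finite ι] (s : Fin n → ι) (r : ι),
    LiftDefinable a b fun x : ι → ℕ => x r = f (List.Vector.ofFn fun i => x (s i))

/-- The variables of the loop that evaluates a primitive recursion with `n` parameters. -/
inductive PrecVar (n : ℕ)
  | param (i : Fin n)
  | bound
  | counter
  | value

section PrimitiveRecursion

open PrecVar

instance (n : ℕ) : Finite (PrecVar n) :=
  .of_surjective (Sum.elim param ![bound, counter, value]) fun
    | param i => ⟨.inl i, rfl⟩
    | bound => ⟨.inr 0, rfl⟩
    | counter => ⟨.inr 1, rfl⟩
    | value => ⟨.inr 2, rfl⟩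

instance (n : ℕ) : Nonempty (PrecVar n) := ⟨bound⟩

/-- The state of the loop with parameters `p` and bound `m` when the counter is `y` and the value
computed so far is `h`. -/
def precState {n : ℕ} (p : List.Vector ℕ n) (m y h : ℕ) : PrecVar n → ℕ
  | param i => p.get i
  | bound => m
  | counter => y
  | value => h

/-- One pass of the loop: the counter always advances, but the value is updated only while the
counter is below the bound, so that further passes do no harm. -/
def precStep {n : ℕ} (g : List.Vector ℕ (n + 2) → ℕ) (z : PrecVar n → ℕ) : PrecVar n → ℕ
  | param i => z (param i)
  | bound => z bound
  | counter => z counter + 1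
  | value => if z counter < z bound then
      g (z counter ::ᵥ z value ::ᵥ List.Vector.ofFn fun i => z (param i)) else z value

theorem iterate_precStep {n : ℕ} (f : List.Vector ℕ n → ℕ) (g : List.Vector ℕ (n + 2) → ℕ)
    (p : List.Vector ℕ n) (m t : ℕ) :
    (precStep g)^[t] (precState p m 0 (f p)) =
      precState p m t ((min t m).rec (f p) fun y IH => g (y ::ᵥ IH ::ᵥ p)) := by
  induction t with
  | zero => simp
  | succ t ih =>
    rw [Function.iterate_succ_apply', ih]
    funext v
    cases v with
    | param | bound | counter => rfl
    | value =>
      simp only [precStep, precState, List.Vector.ofFn_get]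
      split_ifs with h
      · rw [min_eq_left h.le, min_eq_left h]
      · rw [min_eq_right (not_lt.1 h), min_eq_right (by omega)]

namespace FunDefinable

variable {A : Type u} [Finite A] {a b c : A} {m n : ℕ}

theorem comp (hd : Distinct a b c) {f : List.Vector ℕ n → ℕ} {g : Fin n → List.Vector ℕ m → ℕ}
    (hf : FunDefinable a b f) (hg : ∀ i, FunDefinable a b (g i)) :
    FunDefinable a b fun v => f (List.Vector.ofFn fun i => g i v) := fun {ι} _ s r => by
  have : Nonempty ι := ⟨r⟩
  refine (LiftDefinable.exs (P := fun x (y : Fin n → ℕ) =>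
    (∀ i, y i = g i (List.Vector.ofFn fun i => x (s i))) ∧ x r = f (List.Vector.ofFn y)) <|
    .and hd (.all hd fun i => hg i (fun j => Sum.inl (s j)) (Sum.inr i)) <|
    hf (fun i => Sum.inr i) (Sum.inl r)).congr fun x => ?_
  constructor
  · exact fun h => ⟨_, fun i => rfl, h⟩
  · rintro ⟨y, h, h'⟩
    rw [h', funext h]

theorem liftDefinable_precStep (hd : Distinct a b c) {g : List.Vector ℕ (n + 2) → ℕ}
    (hg : FunDefinable a b g) : LiftDefinable a b fun z : PrecVar n ⊕ PrecVar n → ℕ =>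
      ∀ i, z (.inr i) = precStep g (fun i => z (.inl i)) i := by
  refine .all hd fun
    | param i => .eq hd _ _
    | bound => .eq hd _ _
    | counter => .succ hd _ _
    | value => ?_
  refine (LiftDefinable.ex hd (P := fun z p =>
    p = g (z (.inl counter) ::ᵥ z (.inl value) ::ᵥ List.Vector.ofFn fun i => z (.inl (param i))) ∧
      z (.inr value) = if z (.inl counter) < z (.inl bound) then p else z (.inl value)) <|
    .and hd (hg (Fin.cons (some (Sum.inl counter)) (Fin.cons (some (Sum.inl value))
      fun i => some (Sum.inl (param i)))) none) (.ite hd _ _ _ _ _)).congr fun z => ?_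
  simp only [precStep, exists_eq_left]

theorem prec (hd : Distinct a b c) {f : List.Vector ℕ n → ℕ} {g : List.Vector ℕ (n + 2) → ℕ}
    (hf : FunDefinable a b f) (hg : FunDefinable a b g) :
    FunDefinable a b fun v : List.Vector ℕ (n + 1) =>
      v.head.rec (f v.tail) fun y IH => g (y ::ᵥ IH ::ᵥ v.tail) := fun {ι} _ s r => by
  have : Nonempty ι := ⟨r⟩
  let p (x : ι → ℕ) : List.Vector ℕ n := List.Vector.ofFn fun i => x (s i.succ)
  refine (LiftDefinable.exists_iterate hd (F := precStep g) (P := fun x y z =>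
    ((∀ i, y (param i) = x (s i.succ)) ∧ y bound = x (s 0) ∧ y counter = 0 ∧
      y value = f (p x)) ∧ (z bound = x (s 0)) ∧ x (s 0) ≤ z counter ∧ x r = z value)
    (liftDefinable_precStep hd hg) (.and hd (.and hd (.all hd fun _ => .eq hd _ _) <|
      .and hd (.eq hd _ _) <| .and hd (.const hd _ _) <| hf (fun i => Sum.inl (s i.succ)) _) <|
      .and hd (.eq hd _ _) <| .and hd (.le hd _ _) (.eq hd _ _)) ?_).congr fun x => ?_
  · rintro x y z ⟨hy, hb, hc, hr⟩
    refine ⟨hy, hb, hc.trans (Nat.le_succ _), hr.trans ?_⟩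
    rw [← hb] at hc
    simp only [precStep, if_neg hc.not_gt]
  constructor
  · refine fun h => ⟨precState (p x) (x (s 0)) 0 (f (p x)), x (s 0),
      ⟨fun i => List.Vector.get_ofFn _ i, rfl, rfl, rfl⟩, ?_⟩
    rw [iterate_precStep, min_self]
    exact ⟨rfl, le_rfl, h⟩
  · rintro ⟨y, T, ⟨hp, hb, hc, hv⟩, h⟩
    obtain rfl : y = precState (p x) (x (s 0)) 0 (f (p x)) := by
      funext v
      cases v with
      | param i => simp only [hp, p, precState, List.Vector.get_ofFn]
      | bound => exact hb
      | counter => exact hc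
      | value => exact hv
    rw [iterate_precStep] at h
    have hT : x (s 0) ≤ T := h.2.1
    rw [min_eq_right hT] at h
    exact h.2.2

theorem of_primrec' (hd : Distinct a b c) {f : List.Vector ℕ n → ℕ} (hf : Nat.Primrec' f) :
    FunDefinable a b f := by
  induction hf with
  | zero => exact fun _ r => .const hd 0 r
  | succ => exact fun s r => .succ hd r (s 0)
  | get i => exact fun s r => (LiftDefinable.eq hd r (s i)).congr fun x => by simp
  | comp g _ _ ihf ihg => exact comp hd ihf ihg
  | prec _ _ ihf ihg => exact prec hd ihf ihg

end FunDefinable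

end PrimitiveRecursion

section BlockCode

variable {A : Type u} {a b c : A}

/-- The word that represents the natural number `m`. -/
def num (a b : A) (m : ℕ) : List A := replicate m a ++ [b]

theorem enc_one (a b : A) (f : ℕ → ℕ) : enc a b 1 f = num a b (f 0) := by
  simp [enc, num, concat_succ]

theorem num_append_enc_eq_iff (hab : a ≠ b) {n K : ℕ} {g g' : ℕ → ℕ} :
    num a b K ++ enc a b n g = enc a b n g' ++ [b] ↔ ∃ s : ℕ → ℕ,
      s 0 = K ∧ s n = 0 ∧ (∀ t < n, g t = s (t + 1)) ∧ ∀ t < n, g' t = s t := by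
  change _ = _ ++ num a b 0 ↔ _
  rw [← enc_one a b fun _ => K, ← enc_one a b fun _ => 0, enc_append_enc_eq_iff hab]
  simp only [Nat.lt_one_iff, forall_eq, add_zero, add_comm 1, eq_comm (a := K),
    eq_comm (a := 0)]
  exact exists_congr fun s => by tauto

theorem encode_map_range_iff {n K : ℕ} {f : ℕ → ℕ} :
    Encodable.encode ((range n).map f) = K ↔
      ∃ s : ℕ → ℕ, s 0 = K ∧ s n = 0 ∧ ∀ t < n, s t = Nat.pair (f t) (s (t + 1)) + 1 := by
  induction n generalizing f K with
  | zero => exact ⟨fun h => ⟨fun _ => 0, h, rfl, by simp⟩, fun ⟨s, h, h', _⟩ => h'.symm.trans h⟩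
  | succ n ih =>
    rw [range_succ_eq_map, map_cons, map_map, Encodable.encode_list_cons]
    constructor
    · rintro rfl
      obtain ⟨s, h₀, hn, hs⟩ := ih.1 (Eq.refl (Encodable.encode ((range n).map (f ∘ Nat.succ))))
      refine ⟨fun t => t.casesOn (Nat.pair (f 0) (s 0) + 1) s, ?_, hn, fun t ht => ?_⟩
      · rw [h₀]; rfl
      · cases t with
        | zero => rfl
        | succ t => exact hs t (by omega)
    · rintro ⟨s, rfl, hn, hs⟩
      have tail : Encodable.encode ((range n).map (f ∘ Nat.succ)) = s 1 :=
        ih.2 ⟨fun t => s (t + 1), rfl, hn, fun t ht => hs (t + 1) (by omega)⟩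
      rw [tail, hs 0 n.succ_pos]
      rfl

variable [DecidableEq A]

theorem count_num (hab : a ≠ b) (m : ℕ) : (num a b m).count a = m := by
  simp [num, hab.symm]

/-- The effect of a further letter, on the left, on the list of block lengths of a word. -/
def blockStep (a b t : A) (l : List ℕ) : List ℕ :=
  if t = a then (l.headI + 1) :: l.tail else if t = b then 0 :: l else l

/-- The numbers of letters `a` between consecutive letters `b` of a word. -/
def blockLengths (a b : A) (w : List A) : List ℕ :=
  w.foldr (blockStep a b) [0]

/-- A numerical code of the projection of a word to the letters `a` and `b`. -/
def blockCode (a b : A) (w : List A) : ℕ :=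
  Encodable.encode (blockLengths a b w)

theorem foldr_blockStep_replicate (a b : A) (n m : ℕ) (l : List ℕ) :
    (replicate n a).foldr (blockStep a b) (m :: l) = (n + m) :: l := by
  induction n with
  | zero => simp
  | succ n ih =>
    rw [replicate_succ, foldr_cons, ih]
    simp [blockStep, add_right_comm]

theorem foldr_blockStep_enc (hab : a ≠ b) (n : ℕ) (f : ℕ → ℕ) :
    (enc a b n f).foldr (blockStep a b) [] = (range n).map f := by
  induction n generalizing f with
  | zero => rfl
  | succ n ih =>
    rw [enc, concat_succ', ← enc, foldr_append, ih, foldr_append, foldr_cons, foldr_nil,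
      blockStep, if_neg hab.symm, if_pos rfl, foldr_blockStep_replicate, range_succ_eq_map,
      map_cons, map_map, add_zero]
    rfl

theorem blockLengths_filter_onPair (a b : A) (w : List A) :
    blockLengths a b (w.filter (onPair a b)) = blockLengths a b w := by
  induction w with
  | nil => rfl
  | cons t w ih =>
    by_cases h : t = a ∨ t = b
    · rw [filter_cons_of_pos (by simpa [onPair] using h)]
      exact congrArg (blockStep a b t) ih
    · rw [filter_cons_of_neg (by simpa [onPair] using h), ih]
      push Not at h
      simp [blockLengths, blockStep, h]

theorem exists_filter_onPair_append_eq_enc (a b : A) (w : List A) :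
    ∃ n f, w.filter (onPair a b) ++ [b] = enc a b (n + 1) f :=
  exists_append_singleton_eq_enc fun y hy => by simpa [onPair] using (mem_filter.1 hy).2

theorem blockLengths_eq (hab : a ≠ b) {w : List A} {n : ℕ} {f : ℕ → ℕ}
    (h : w.filter (onPair a b) ++ [b] = enc a b n f) : blockLengths a b w = (range n).map f := by
  rw [← blockLengths_filter_onPair, ← foldr_blockStep_enc hab, ← h, foldr_append]
  simp [blockLengths, blockStep, hab.symm]

theorem filter_onPair_eq_of_blockCode_eq (hab : a ≠ b) {u v : List A}
    (h : blockCode a b u = blockCode a b v) : u.filter (onPair a b) = v.filter (onPair a b) := by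
  obtain ⟨n, f, hu⟩ := exists_filter_onPair_append_eq_enc a b u
  obtain ⟨m, g, hv⟩ := exists_filter_onPair_append_eq_enc a b v
  have hfg := Encodable.encode_injective h
  rw [blockLengths_eq hab hu, blockLengths_eq hab hv] at hfg
  obtain rfl : n = m := by simpa using congrArg length hfg
  rw [← enc_congr fun t ht => map_inj_left.1 hfg t (mem_range.2 ht), ← hu] at hv
  exact (append_cancel_right hv).symm

/-- The words `C'` and `C` code the sequence of the codes of the final segments of the list of
block lengths, without its last and without its first entry. -/
theorem eq_num_blockCode_iff (hd : Distinct a b c) (w K : List A) :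
    K = num a b (blockCode a b w) ↔ (∃ N, K = num a b N) ∧
      ∃ u, u = w.filter (onPair a b) ∧ ∃ p, p = [b] ∧ ∃ X, (c ∉ u ∧ c ∉ p ∧ X = u ++ p) ∧
      ∃ C C', Lift a b (fun x : Fin 3 → ℕ => x 2 = Nat.pair (x 0) (x 1) + 1) ![X, C, C'] ∧
      ∃ W, (c ∉ K ∧ c ∉ C ∧ W = K ++ C) ∧ (c ∉ C' ∧ c ∉ p ∧ W = C' ++ p) := by
  have hc {n f} : c ∉ enc a b n f := notMem_enc hd.ac hd.bc.symm
  have hcnum {m} : c ∉ num a b m := enc_one a b (fun _ => m) ▸ hc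
  have hcb : c ∉ [b] := hcnum (m := 0)
  have hcu : c ∉ w.filter (onPair a b) := by simp [onPair, hd.ac.symm, hd.bc.symm]
  obtain ⟨n, f, hf⟩ := exists_filter_onPair_append_eq_enc a b w
  rw [blockCode, blockLengths_eq hd.ab hf]
  constructor
  · rintro rfl
    obtain ⟨s, h₀, hn, hs⟩ := encode_map_range_iff.1 <|
      Eq.refl (Encodable.encode ((range (n + 1)).map f))
    refine ⟨⟨_, rfl⟩, _, rfl, _, rfl, _, ⟨hcu, hcb, rfl⟩, enc a b (n + 1) fun t => s (t + 1),
      enc a b (n + 1) s, ⟨n + 1, ![f, fun t => s (t + 1), s], hs, ?_⟩, _,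
      ⟨hcnum, hc, rfl⟩, hc, hcb, ?_⟩
    · exact Fin.forall_fin_succ.2 ⟨hf, Fin.forall_fin_two.2 ⟨rfl, rfl⟩⟩
    · exact (num_append_enc_eq_iff hd.ab).2 ⟨s, h₀, hn, fun _ _ => rfl, fun _ _ => rfl⟩
  · rintro ⟨⟨N, rfl⟩, _, rfl, _, rfl, _, ⟨-, -, rfl⟩, C, C', ⟨m, x, hR, hx⟩, _, ⟨-, -, rfl⟩,
      -, -, h⟩
    obtain ⟨rfl, hfx⟩ := enc_inj hd.ab (hf.symm.trans (hx 0))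
    obtain rfl : C = _ := hx 1
    obtain rfl : C' = _ := hx 2
    obtain ⟨s, h₀, hn, h₁, h₂⟩ := (num_append_enc_eq_iff hd.ab).1 h
    rw [encode_map_range_iff.2 ⟨s, h₀, hn, fun t ht => ?_⟩]
    rw [← h₂ t ht, hfx t ht, ← h₁ t ht]
    exact hR t ht

end BlockCode

namespace Definable

variable {A : Type u} [Finite A] {α : Type} {a b c : A}

theorem exists_eq_num (hab : a ≠ b) (i : α) :
    Definable fun v : α → List A => ∃ m, v i = num a b m :=
  exists_eq_replicate_append_cons hab 0 i

theorem exists_eq_num_and_eq_num (hd : Distinct a b c) {f : ℕ → ℕ} (hf : Primrec f) (i j : α) :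
    Definable fun v : α → List A => ∃ m, v i = num a b m ∧ v j = num a b (f m) := by
  have graph : LiftDefinable a b fun x : Fin 2 → ℕ => x 1 = f (x 0) :=
    FunDefinable.of_primrec' hd (f := fun v : List.Vector ℕ 1 => f v.head)
      (Nat.Primrec'.prim_iff₁.2 hf) ![0] 1
  refine ((exists_eq_num hd.ab i).and (subst graph ![i, j])).congr fun v => ?_
  constructor
  · rintro ⟨m, hi, hj⟩
    exact ⟨⟨m, hi⟩, 1, ![fun _ => m, fun _ => f m], fun _ _ => rfl, Fin.forall_fin_two.2
      ⟨hi.trans (enc_one a b fun _ => m).symm, hj.trans (enc_one a b fun _ => f m).symm⟩⟩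
  · rintro ⟨⟨m, hi⟩, n, x, hR, hx⟩
    obtain ⟨rfl, hm⟩ :=
      enc_inj hd.ab ((enc_one a b fun _ => m).trans (hi.symm.trans (hx 0)))
    refine ⟨m, hi, (hx 1).trans ?_⟩
    rw [enc_one, hm 0 one_pos]
    exact congrArg _ (hR 0 one_pos)

variable [DecidableEq A]

theorem eq_num_blockCode (hd : Distinct a b c) (i j : α) :
    Definable fun v : α → List A => v j = num a b (blockCode a b (v i)) := by
  have := nontrivial_of_ne a b hd.ab
  have graph : LiftDefinable a b fun x : Fin 3 → ℕ => x 2 = Nat.pair (x 0) (x 1) + 1 :=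
    FunDefinable.of_primrec' hd (f := fun v : List.Vector ℕ 2 => Nat.pair v.head v.tail.head + 1)
      (Nat.Primrec'.prim_iff₂.2 (Primrec.succ.comp₂ Primrec₂.natPair)) ![0, 1] 2
  have cons_graph {β : Type} (p q r : β) : Definable fun v : β → List A =>
      Lift a b (fun x : Fin 3 → ℕ => x 2 = Nat.pair (x 0) (x 1) + 1) ![v p, v q, v r] :=
    (subst graph ![p, q, r]).congr fun v => by
      rw [show ![v p, v q, v r] = fun i => v (![p, q, r] i) from
        funext fun i => by fin_cases i <;> rfl]
  exact ((exists_eq_num hd.ab _).and <| ex <| (filter _ _ _).and <| ex <|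
    (eq_const _ _).and <| ex <| (append _ _ _ _).and <| ex <| ex <| (cons_graph _ _ _).and <| ex <|
    (append _ _ _ _).and (append _ _ _ _)).congr fun _ => eq_num_blockCode_iff hd _ _

theorem apply_count_eq_count (hd : Distinct a b c) {f : ℕ → ℕ} (hf : Primrec f) (i j : α) :
    Definable fun v : α → List A => f ((v i).count a) = (v j).count a := by
  have := nontrivial_of_ne a b hd.ab
  refine (ex (P := fun v p => p.count a = (v i).count a ∧ ∃ q,
    (∃ m, p = num a b m ∧ q = num a b (f m)) ∧ q.count a = (v j).count a) <|
    (count_eq_count _ _ _).and <| ex <| (exists_eq_num_and_eq_num hd hf _ _).and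
      (count_eq_count _ _ _)).congr fun v => ?_
  constructor
  · intro h
    exact ⟨_, count_num hd.ab _, _, ⟨_, rfl, rfl⟩, (count_num hd.ab _).trans h⟩
  · rintro ⟨_, hi, _, ⟨m, rfl, rfl⟩, hj⟩
    rw [← hi, ← hj, count_num hd.ab, count_num hd.ab]

theorem count_eq_blockCode (hd : Distinct a b c) (i j : α) :
    Definable fun v : α → List A => (v j).count a = blockCode a b (v i) := by
  have := nontrivial_of_ne a b hd.ab
  refine (ex (P := fun v p => p = num a b (blockCode a b (v i)) ∧ (v j).count a = p.count a) <|
    (eq_num_blockCode hd _ _).and (count_eq_count _ _ _)).congr fun v => ?_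
  rw [exists_eq_left, count_num hd.ab]

theorem count_eq_count_of_distinct (hd : Distinct a b c) (i j : α) :
    Definable fun v : α → List A => (v i).count a = (v j).count b := by
  have := nontrivial_of_ne a b hd.ab
  refine (ex (P := fun v p => (∃ n, p = enc a b n fun _ => 1) ∧
    (v i).count a = p.count a ∧ (v j).count b = p.count b) <|
    (exists_eq_enc_const hd.ac hd.ab hd.bc.symm _ _).and <|
    (count_eq_count _ _ _).and (count_eq_count _ _ _)).congr fun v => ?_
  have count_left (n : ℕ) : (enc a b n fun _ => 1).count a = n := by simp [count_enc_left hd.ab]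
  constructor
  · intro h
    exact ⟨_, ⟨_, rfl⟩, (count_left _).symm, h.symm.trans (count_enc_right hd.ab _ _).symm⟩
  · rintro ⟨_, ⟨n, rfl⟩, hi, hj⟩
    rw [hi, hj, count_left, count_enc_right hd.ab]

end Definable

section Computability

variable {α β : Type*} [Primcodable α] [Primcodable β]

theorem rePred_comp {p : β → Prop} (hp : REPred p) {f : α → β} (hf : Primrec f) :
    REPred fun x => p (f x) :=
  Partrec.comp hp hf.to_comp

theorem rePred_exists_nat {p : α → ℕ → Prop} (hp : PrimrecRel p) :
    REPred fun x => ∃ n, p x n := by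
  classical
  have search : Partrec fun x => Nat.rfind fun n => Part.some (decide (p x n)) :=
    Partrec.rfind hp.decide.to_comp.partrec₂
  refine search.dom_re.of_eq fun x => Nat.rfind_dom.trans (exists_congr fun n => ?_)
  simp

theorem exists_primrecRel_of_rePred {p : α → Prop} (h : REPred p) :
    ∃ q : α → ℕ → Prop, PrimrecRel q ∧ ∀ x, p x ↔ ∃ n, q x n := by
  obtain ⟨c, hc⟩ := Nat.Partrec.Code.exists_code.1 h
  refine ⟨fun x n => (c.evaln n (Encodable.encode x)).isSome, ?_, fun x => ?_⟩
  · refine Primrec.primrecPred ?_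
    simp only [Bool.decide_eq_true]
    exact Primrec.option_isSome.comp (Nat.Partrec.Code.primrec_evaln.comp
      ((Primrec.snd.pair (Primrec.const c)).pair (Primrec.encode.comp Primrec.fst)))
  · have dom_iff : p x ↔ (c.eval (Encodable.encode x)).Dom := by
      rw [hc]
      simp only [Encodable.encodek, Part.coe_some, Part.bind_some]
      exact ⟨fun h => ⟨h, trivial⟩, fun ⟨h, _⟩ => h⟩
    rw [dom_iff, Part.dom_iff_mem]
    simp only [Nat.Partrec.Code.evaln_complete, Option.isSome_iff_exists, Option.mem_def]
    exact exists_comm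

theorem exists_primrec_enum_of_rePred {p : α → Prop} (h : REPred p) :
    ∃ e : ℕ → Option α, Primrec e ∧ ∀ x, p x ↔ ∃ m, e m = some x := by
  classical
  obtain ⟨q, hq, hp⟩ := exists_primrecRel_of_rePred h
  refine ⟨fun m => (Encodable.decode (α := α × ℕ) m).bind fun r =>
    if q r.1 r.2 then some r.1 else none, ?_, fun x => ?_⟩
  · have first : Primrec fun r : ℕ × α × ℕ => r.2.1 := Primrec.fst.comp Primrec.snd
    exact Primrec.option_bind Primrec.decode <| Primrec.ite
      (hq.comp first (Primrec.snd.comp Primrec.snd)) (Primrec.option_some.comp first)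
      (Primrec.const none)
  · rw [hp]
    constructor
    · rintro ⟨n, hn⟩
      exact ⟨Encodable.encode (x, n), by simp [hn]⟩
    · rintro ⟨m, hm⟩
      obtain ⟨⟨y, n⟩, -, hy⟩ := Option.bind_eq_some_iff.1 hm
      obtain ⟨hn, rfl⟩ : q y n ∧ y = x := by simpa using hy
      exact ⟨n, hn⟩

theorem rePred_exists {p : α → β → Prop} (h : REPred fun r : α × β => p r.1 r.2) :
    REPred fun x => ∃ y, p x y := by
  obtain ⟨e, he, hp⟩ := exists_primrec_enum_of_rePred h
  have fst_eq : PrimrecRel fun x m => (e m).map Prod.fst = some x :=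
    Primrec.eq.comp (Primrec.option_map (he.comp Primrec.snd) (Primrec.fst.comp Primrec.snd).to₂)
      (Primrec.option_some.comp Primrec.fst)
  refine (rePred_exists_nat fst_eq).of_eq fun x => ?_
  simp only [Option.map_eq_some_iff, Prod.exists, exists_and_right, exists_eq_right]
  exact exists_comm.trans (exists_congr fun y => (hp (x, y)).symm)

end Computability

section Sublist

variable {A : Type u} [DecidableEq A]

/-- The remainder of the pattern `r` after the letter `t` has been read, in the greedy search for
`r` as a subword. -/
def dropLetter (r : List A) (t : A) : List A := if r.head? = some t then r.tail else r

theorem foldl_dropLetter_eq_nil_iff (l₁ l₂ : List A) :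
    l₂.foldl dropLetter l₁ = [] ↔ l₁ <+ l₂ := by
  induction l₂ generalizing l₁ with
  | nil => simp
  | cons t l₂ ih =>
    rw [foldl_cons, ih]
    rcases l₁ with _ | ⟨x, l₁⟩
    · simp [dropLetter]
    · by_cases h : x = t
      · subst h
        simp [dropLetter]
      · simp only [dropLetter, head?_cons, Option.some.injEq, h, if_false]
        exact ⟨fun h => h.cons _, fun h' => h'.of_cons_of_ne h⟩

omit [DecidableEq A] in
theorem primrecRel_sublist [Primcodable A] : PrimrecRel fun l₁ l₂ : List A => l₁ <+ l₂ := by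
  classical
  have primrec_dropLetter :
      Primrec₂ fun (_ : List A × List A) (q : List A × A) => dropLetter q.1 q.2 := by
    have pattern : Primrec fun q : (List A × List A) × List A × A => q.2.1 :=
      Primrec.fst.comp Primrec.snd
    exact Primrec.ite (Primrec.eq.comp (Primrec.list_head?.comp pattern)
      (Primrec.option_some.comp (Primrec.snd.comp Primrec.snd)))
      (Primrec.list_tail.comp pattern) pattern
  have := Primrec.eq.comp (Primrec.list_foldl Primrec.snd Primrec.fst primrec_dropLetter)
    (Primrec.const ([] : List A))
  exact this.of_eq fun q => foldl_dropLetter_eq_nil_iff q.1 q.2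

end Sublist

section Formula

open Language

variable {A : Type u} [Primcodable A] {k n : ℕ}

theorem primrec_realize_term (t : (subwordLanguage A).Term (Fin k ⊕ Fin n)) :
    Primrec fun q : (Fin k → List A) × (Fin n → List A) => t.realize (Sum.elim q.1 q.2) := by
  induction t with
  | var i =>
    rcases i with i | i
    · exact Primrec.fin_app.comp Primrec.fst (Primrec.const i)
    · exact Primrec.fin_app.comp Primrec.snd (Primrec.const i)
  | @func l f ts _ =>
    rcases f with f | f
    · exact f.elim
    · rcases l with _ | l
      · exact Primrec.const (α := (Fin k → List A) × (Fin n → List A)) (show List A from f)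
      · exact f.elim

theorem primrecPred_realize {φ : (subwordLanguage A).BoundedFormula (Fin k) n} (h : φ.IsQF) :
    PrimrecPred fun q : (Fin k → List A) × (Fin n → List A) => φ.Realize q.1 q.2 := by
  classical
  induction h with
  | falsum => exact (Primrec.const false).primrecPred (p := fun _ => False)
  | of_isAtomic h =>
    rcases h with ⟨t₁, t₂⟩ | ⟨R, ts⟩
    · exact (Primrec.eq.comp (primrec_realize_term t₁) (primrec_realize_term t₂)).of_eq fun _ =>
        Iff.rfl
    · rcases R with R | R
      · cases R
        exact (primrecRel_sublist.comp (primrec_realize_term (ts 0))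
          (primrec_realize_term (ts 1))).of_eq fun _ => Iff.rfl
      · exact R.elim
  | imp _ _ h₁ h₂ =>
    refine (h₁.not.or h₂).of_eq fun q => ?_
    rw [BoundedFormula.realize_imp, imp_iff_not_or]

theorem rePred_realize {φ : (subwordLanguage A).BoundedFormula (Fin k) n}
    (h : φ.IsExistential) :
    REPred fun q : (Fin k → List A) × (Fin n → List A) => φ.Realize q.1 q.2 := by
  induction h with
  | of_isQF h => exact (primrecPred_realize h).computablePred.to_re
  | @ex n φ _ ih =>
    have primrec_snoc : Primrec fun q : ((Fin k → List A) × (Fin n → List A)) × List A =>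
        (Fin.snoc q.1.2 q.2 : Fin (n + 1) → List A) := by
      refine Primrec.fin_curry.2 (Primrec₂.swap (Primrec.fin_curry₁.2 fun i => ?_))
      induction i using Fin.lastCases with
      | last => simpa only [Fin.snoc_last] using Primrec.snd
      | cast i =>
        simpa only [Fin.snoc_castSucc, id] using
          Primrec.fin_app.comp (Primrec.snd.comp Primrec.fst) (Primrec.const i)
    have realize_snoc : REPred fun q : ((Fin k → List A) × (Fin n → List A)) × List A =>
        φ.Realize q.1.1 (Fin.snoc q.1.2 q.2) :=
      rePred_comp ih ((Primrec.fst.comp Primrec.fst).pair primrec_snoc)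
    exact (rePred_exists realize_snoc).of_eq fun q => BoundedFormula.realize_ex.symm

theorem rePred_of_sigmaOneDefinable {R : Set (Fin k → List A)} (h : SigmaOneDefinable R) :
    REPred fun v : Fin k → List A => v ∈ R := by
  obtain ⟨φ, hφ, hR⟩ := h
  exact (rePred_comp (rePred_realize hφ) (Primrec.id.pair (Primrec.const _))).of_eq
    fun v => (hR v).symm

end Formula

section Enumerable

variable {A : Type u}

theorem exists_distinct [Fintype A] (hA : 3 ≤ Fintype.card A) {a b : A} (hab : a ≠ b) :
    ∃ c, Distinct a b c := by
  classical
  obtain ⟨c, hc⟩ := Finset.exists_mem_notMem_of_card_lt_card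
    (s := {a, b}) (t := Finset.univ) (Finset.card_le_two.trans_lt hA)
  simp only [Finset.mem_univ, Finset.mem_insert, Finset.mem_singleton, not_or, true_and] at hc
  exact ⟨c, hab, Ne.symm hc.1, Ne.symm hc.2⟩

variable [DecidableEq A]

theorem eq_of_blockCode_eq [Nontrivial A] {u v : List A}
    (h : ∀ x y, x ≠ y → blockCode x y u = blockCode x y v) : u = v :=
  eq_of_filter_onPair (S := Set.univ)
    (fun y _ => (exists_ne y).imp fun _ hx => ⟨Set.mem_univ _, hx⟩)
    (fun _ _ => Set.mem_univ _) (fun _ _ => Set.mem_univ _)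
    fun x _ y _ hxy => filter_onPair_eq_of_blockCode_eq hxy (h x y hxy)

variable [Primcodable A]

theorem primrec_blockCode (x y : A) : Primrec (blockCode x y) := by
  have primrec_blockStep : Primrec₂ fun (_ : List A) (q : A × List ℕ) => blockStep x y q.1 q.2 := by
    have letter : Primrec fun q : List A × A × List ℕ => q.2.1 := Primrec.fst.comp Primrec.snd
    have lengths : Primrec fun q : List A × A × List ℕ => q.2.2 := Primrec.snd.comp Primrec.snd
    exact Primrec.ite (Primrec.eq.comp letter (Primrec.const x))
      (Primrec.list_cons.comp (Primrec.succ.comp (Primrec.list_headI.comp lengths))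
        (Primrec.list_tail.comp lengths))
      (Primrec.ite (Primrec.eq.comp letter (Primrec.const y))
        (Primrec.list_cons.comp (Primrec.const 0) lengths) lengths)
  exact Primrec.encode.comp (Primrec.list_foldr Primrec.id (Primrec.const [0]) primrec_blockStep)

theorem exists_primrec_blockCode [Nontrivial A] {k : ℕ} {R : Set (Fin k → List A)}
    (h : REPred fun v : Fin k → List A => v ∈ R) :
    ∃ (G : ℕ → ℕ) (F : Fin k → A → A → ℕ → ℕ), Primrec G ∧ (∀ i x y, Primrec (F i x y)) ∧
      ∀ v, v ∈ R ↔ ∃ m, G m = 0 ∧ ∀ i x y, x ≠ y → F i x y m = blockCode x y (v i) := by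
  obtain ⟨e, he, hR⟩ := exists_primrec_enum_of_rePred h
  refine ⟨fun m => ((e m).map fun _ => 0).getD 1,
    fun i x y m => ((e m).map fun w => blockCode x y (w i)).getD 0, ?_, fun i x y => ?_,
    fun v => (hR v).trans (exists_congr fun m => ?_)⟩
  · exact Primrec.option_getD.comp (Primrec.option_map he (Primrec.const 0).to₂) (Primrec.const _)
  · exact Primrec.option_getD.comp (Primrec.option_map he ((primrec_blockCode x y).comp
      (Primrec.fin_app.comp Primrec.snd (Primrec.const i))).to₂) (Primrec.const _)
  · beta_reduce
    rcases e m with _ | w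
    · simp
    · simp only [Option.some.injEq, Option.map_some, Option.getD_some, true_and]
      exact ⟨fun h i x y _ => by rw [h], fun h => funext fun i => eq_of_blockCode_eq (h i)⟩

end Enumerable

namespace Definable

variable {A : Type u} [Fintype A] [DecidableEq A] {α : Type}

theorem count_eq_count_of_three_le_card (hA : 3 ≤ Fintype.card A) (a b : A) (i j : α) :
    Definable fun v : α → List A => (v i).count a = (v j).count b := by
  have : Nontrivial A := Fintype.one_lt_card_iff_nontrivial.1 (by omega)
  rcases eq_or_ne a b with rfl | hab
  · exact count_eq_count _ _ _
  · exact (exists_distinct hA hab).elim fun c hd => count_eq_count_of_distinct hd _ _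

theorem apply_count_eq_blockCode (hA : 3 ≤ Fintype.card A) {a x y : A} (hxy : x ≠ y)
    {f : ℕ → ℕ} (hf : Primrec f) (i j : α) :
    Definable fun v : α → List A => f ((v i).count a) = blockCode x y (v j) := by
  obtain ⟨z, hd⟩ := exists_distinct hA hxy
  refine (ex (P := fun v p => (v i).count a = p.count x ∧ ∃ q, f (p.count x) = q.count x ∧
    q.count x = blockCode x y (v j)) <|
    (count_eq_count_of_three_le_card hA _ _ _ _).and <| ex <|
      (apply_count_eq_count hd hf _ _).and (count_eq_blockCode hd _ _)).congr fun v => ?_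
  constructor
  · intro h
    exact ⟨num x y _, (count_num hxy _).symm, num x y (blockCode x y (v j)),
      by rw [count_num hxy, count_num hxy, h], count_num hxy _⟩
  · rintro ⟨p, hp, q, hpq, hq⟩
    rw [hp, hpq, hq]

omit [DecidableEq A] in
theorem of_rePred [Primcodable A] (hA : 3 ≤ Fintype.card A) {k : ℕ}
    {R : Set (Fin k → List A)} (h : REPred fun v : Fin k → List A => v ∈ R) :
    Definable fun v => v ∈ R := by
  classical
  have : Nontrivial A := Fintype.one_lt_card_iff_nontrivial.1 (by omega)
  obtain ⟨a, b, hab⟩ := exists_pair_ne A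
  obtain ⟨c, hd⟩ := exists_distinct hA hab
  obtain ⟨G, F, hG, hF, hR⟩ := exists_primrec_blockCode h
  refine (ex (P := fun v p => (∃ z, z = [] ∧ G (p.count a) = z.count a) ∧
    ∀ i x y, x ≠ y → F i x y (p.count a) = blockCode x y (v i)) <|
    (ex <| (eq_const _ _).and (apply_count_eq_count hd hG _ _)).and <|
      all fun i => all fun x => all fun y => const_imp _ fun hxy =>
        apply_count_eq_blockCode hA hxy (hF i x y) _ _).congr fun v => ?_
  simp only [hR, exists_eq_left, count_nil]
  exact ⟨fun ⟨m, h⟩ => ⟨num a b m, by rwa [count_num hab]⟩, fun ⟨p, h⟩ => ⟨_, h⟩⟩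

end Definable

end Subword

theorem theorem2p1 {A : Type*} [Fintype A] [Primcodable A] (hA : 3 ≤ Fintype.card A)
    {k : ℕ} (R : Set (Fin k → List A)) :
    SigmaOneDefinable R ↔ REPred (fun v : Fin k → List A => v ∈ R) := by
  classical
  exact ⟨Subword.rePred_of_sigmaOneDefinable, fun h =>
    (Subword.Definable.of_rePred hA h).sigmaOneDefinable⟩
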